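/- Let $\lambda>0$, $\sigma_w^2>0$, and let $\sigma_m^2\ge 0$ ($m\in\mathbb Z$) satisfy $P:=\sum_{m}\sigma_m^2<\infty$. Let $\beta_m\sim\mathcal{CN}(0,\sigma_m^2)$ ($m\in\mathbb Z$) be independent circular complex Gaussian variables and let $w_x\sim\mathcal{CN}(0,\sigma_w^2)$ ($x\in\mathbb R$) be independent noise variables, independent of $(\beta_m)_m$. With $\operatorname{sinc}(t)=\frac{\sin \pi t}{\pi t}$ and a finite set $\mathcal M\subset\mathbb Z$, define for every finite set $\mathcal S\subset\mathbb R$ of sensor positions the measurement vectors of the infinite and of the truncated model, $$\tilde{\boldsymbol f}_{\mathcal S}=\Big(\sum_{m\in\mathbb Z}\operatorname{sinc}\big(m+\tfrac{2}{\lambda}x\big)\beta_m+w_x\Big)_{x\in\mathcal S},\qquad \hat{\boldsymbol f}_{\mathcal S}=\Big(\sum_{m\in\mathcal M}\operatorname{sinc}\big(m+\tfrac{2}{\lambda}x\big)\beta_m+w_x\Big)_{x\in\mathcal S},$$ and let $\boldsymbol\beta=(\beta_m)_{m\in\mathcal M}$. Let $I(\cdot\,;\cdot)$ denote mutual information in nats.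 Let $\epsilon=\sum_{m\notin\mathcal M}\sigma_m^2$ and let $N$ be a number of sensors with $\epsilon N^{3/2}<\sigma_w^2$. Let $\mathcal A\subseteq\mathbb R$ be an aperture, $\delta>0$, and let $\mathcal V\subseteq\mathcal A$ be a uniform $\delta$-spaced grid in $\mathcal A$ with at least $N$ points: $\mathcal V=\{x_0,x_0+\delta,\dots,x_0+(K-1)\delta\}$ with $K\ge N$, and every point of $\mathcal A$ is at distance less than $\delta$ from $\mathcal V$ (for an interval $\mathcal A$ and $K\ge 1$ this means $\mathcal V=\mathcal A\cap(x_0+\delta\mathbb Z)$). Let $\mathcal S^{\mathrm{gr}}$ be any set produced by $N$ rounds of the greedy algorithm which starts from $\emptyset$ and in each round adds to the current set $\mathcal S$ an element $x\in\mathcal V\setminus\mathcal S$ that maximizes $I(\hat{\boldsymbol f}_{\mathcal S\cup\{x\}};\boldsymbol\beta)$, with ties broken arbitrarily. Then $I(\tilde{\boldsymbol f}_{\mathcal S};\{\beta_m\})$ and $I(\hat{\boldsymbol f}_{\mathcal S};\boldsymbol\beta)$ are finite for every finite $\mathcal S\subset\mathbb R$, and for every $\mathcal S\subseteq\mathcal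 A$ with $|\mathcal S|\le N$ (hence for every maximizer $\mathcal S^\star$ of $I(\tilde{\boldsymbol f}_{\mathcal S};\{\beta_m\})$ over these sets, and, where no maximizer exists, for the supremum) $$\Big(1-\frac1e\Big)\left[I(\tilde{\boldsymbol f}_{\mathcal S};\{\beta_m\})-N\log\frac{\lambda\sigma_w^2+4\delta P(1+\delta)N^{3/2}}{\lambda\sigma_w^2-\epsilon\lambda N^{3/2}}\right]\le I(\hat{\boldsymbol f}_{\mathcal S^{\mathrm{gr}}};\boldsymbol\beta).$$ -/

import Mathlib

open MeasureTheory ProbabilityTheory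
open scoped NNReal ENNReal

namespace ArrayDesign

noncomputable section

/-- The circular complex Gaussian law `CN(0, v)`: real and imaginary parts are independent and
`N(0, v / 2)`, so that the second absolute moment is `v`. -/
def circularGaussian (v : ℝ≥0) : Measure ℂ :=
  ((gaussianReal 0 (v / 2)).prod (gaussianReal 0 (v / 2))).map
    (fun p : ℝ × ℝ => (p.1 : ℂ) + (p.2 : ℂ) * Complex.I)

/-- Mutual information (in nats) of two random variables: the Kullback-Leibler divergence of
their joint law from the product of their laws. -/
def mutualInfo {Ω α γ : Type*} [MeasurableSpace Ω] [MeasurableSpace α] [MeasurableSpace γ]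
    (X : Ω → α) (Y : Ω → γ) (μ : Measure Ω) : ℝ≥0∞ :=
  InformationTheory.klDiv (μ.map (fun ω => (X ω, Y ω))) ((μ.map X).prod (μ.map Y))

/-- The coefficient `sinc (m + 2 x / lam)`, `sinc t = sin (π t) / (π t)`, with which the `m`-th
Fourier coefficient of the scene enters the noiseless reading at position `x`.
(`Real.sinc u` is `sin u / u`.) -/
def coeff (lam x : ℝ) (m : ℤ) : ℝ :=
  Real.sinc (Real.pi * ((m : ℝ) + 2 / lam * x))

variable {Ω : Type*}

/-- Noisy readings of the infinite model at the sensor positions in `S`. -/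
def fullReading (lam : ℝ) (β : ℤ → Ω → ℂ) (w : ℝ → Ω → ℂ) (S : Finset ℝ) (ω : Ω) :
    {x // x ∈ S} → ℂ :=
  fun x => (∑' m : ℤ, (coeff lam x.1 m : ℂ) * β m ω) + w x.1 ω

/-- Noisy readings of the model truncated to the coefficients with index in `M`. -/
def truncReading (lam : ℝ) (M : Finset ℤ) (β : ℤ → Ω → ℂ) (w : ℝ → Ω → ℂ) (S : Finset ℝ)
    (ω : Ω) : {x // x ∈ S} → ℂ :=
  fun x => (∑ m ∈ M, (coeff lam x.1 m : ℂ) * β m ω) + w x.1 ω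

/-- Information about the whole sequence of coefficients in the readings of the infinite model. -/
def fullInfo [MeasurableSpace Ω] (μ : Measure Ω) (lam : ℝ) (β : ℤ → Ω → ℂ) (w : ℝ → Ω → ℂ)
    (S : Finset ℝ) : ℝ≥0∞ :=
  mutualInfo (fullReading lam β w S) (fun ω (m : ℤ) => β m ω) μ

/-- Information about the truncated vector of coefficients in the readings of the truncated
model. -/
def truncInfo [MeasurableSpace Ω] (μ : Measure Ω) (lam : ℝ) (M : Finset ℤ) (β : ℤ → Ω → ℂ)
    (w : ℝ → Ω → ℂ) (S : Finset ℝ) : ℝ≥0∞ :=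
  mutualInfo (truncReading lam M β w S) (fun ω (m : {m // m ∈ M}) => β m.1 ω) μ

/-- `V` is a uniform grid of positions in the aperture `A` with distance `δ` between adjacent
positions, extending over all of `A`: every point of `A` is at distance less than `δ` from `V`.
When `A` is an interval this says that `V` is nonempty (or `A` is empty) and consists of all the
points of a lattice `x₀ + δ ℤ` that lie in `A`. -/
def IsUniformGrid (A : Set ℝ) (δ : ℝ) (V : Finset ℝ) : Prop :=
  ∃ (x₀ : ℝ) (K : ℕ), V = (Finset.range K).image (fun k : ℕ => x₀ + (k : ℝ) * δ) ∧
    (V : Set ℝ) ⊆ A ∧ ∀ x ∈ A, ∃ v ∈ V, |x - v| < δ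

/-- `GreedyRun G V n S`: starting from the empty set, `n` rounds of the greedy algorithm for the
set function `G` on the ground set `V` may end with `S`. A round adds an element of `V` not
selected yet that maximizes `G`; ties are broken arbitrarily. -/
inductive GreedyRun (G : Finset ℝ → ℝ) (V : Finset ℝ) : ℕ → Finset ℝ → Prop
  | zero : GreedyRun G V 0 ∅
  | step {n : ℕ} {S : Finset ℝ} {x : ℝ} : GreedyRun G V n S → x ∈ V \ S →
      (∀ y ∈ V \ S, G (insert y S) ≤ G (insert x S)) → GreedyRun G V (n + 1) (insert x S)

end

end ArrayDesign

/-! Attach to each position `x` the vector `a x` in `ℓ²` with entries `σ_m sinc(m + 2x/λ)`. Inner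
products of these vectors are covariances of noiseless readings, and the mutual information of
either model is `log det (I + Gram / v)` (`mutualInfo_linear_gaussian`); truncation merely sets the
variances outside `M` to zero. The rest is geometry of vectors in a Hilbert space.

By a Schur complement, a new reading adds `log (r / v)`, where `r` is `v` plus the minimal cost of
ridge regression of the new vector on the old ones (`exists_logDetInfo_insert`). Testing this
minimum with suitable coefficients shows that the information is monotone and submodular, that
moving a sensor costs little (`logDetInfo_insert_le_of_norm_sub_le`), and that the orthogonal tail
of the series adds at most `log (1 + N ε / v)` per sensor (`logDetInfo_add_orthogonal_le`).

A competitor in the aperture is first truncated and then moved onto distinct grid points, one sensor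
at a time. The `i`-th move has length at most `i δ`, and concavity of the logarithm replaces `i` by
its mean `(n + 1) / 2`. Since `sinc (π ·)` enters with Lipschitz constant `π / λ` in `x`, the loss
per sensor is at most `log (1 + π δ P (N + 1) / (λ v))`, which the stated term dominates for `N ≥
2`. The classical `1 - 1 / e` bound then compares the greedy set with the moved competitor. For `N =
1` the stated term is too small for this argument, but a single greedy round is optimal on the grid,
and the unused factor `1 - 1 / e` makes up the difference. -/

namespace ArrayDesign

open scoped RealInnerProductSpace

/-! ### Log-determinant information through ridge regression -/

section RidgeRegression

variable {H : Type*} [NormedAddCommGroup H] [InnerProductSpace ℝ H]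

/-- The Gram matrix of the vectors `a i`, with `v` added on the diagonal: the covariance matrix of
noisy readings. -/
noncomputable def noisyGram {κ : Type*} [DecidableEq κ] (v : ℝ) (a : κ → H) : Matrix κ κ ℝ :=
  Matrix.gram ℝ a + v • (1 : Matrix κ κ ℝ)

/-- The objective of the ridge regression of `x` on the vectors `a i`, plus the noise variance
`v`. -/
noncomputable def ridgeCost {κ : Type*} [Fintype κ] (v : ℝ) (a : κ → H) (x : H) (c : κ → ℝ) : ℝ :=
  v + ‖x - ∑ i, c i • a i‖ ^ 2 + v * ∑ i, c i ^ 2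

lemma dotProduct_noisyGram_mulVec {κ : Type*} [Fintype κ] [DecidableEq κ] (v : ℝ) (a : κ → H)
    (c : κ → ℝ) :
    c ⬝ᵥ (noisyGram v a).mulVec c = ‖∑ i, c i • a i‖ ^ 2 + v * ∑ i, c i ^ 2 := by
  have h := Matrix.star_dotProduct_gram_mulVec (𝕜 := ℝ) a c c
  rw [real_inner_self_eq_norm_sq, star_trivial] at h
  rw [noisyGram, Matrix.add_mulVec, dotProduct_add, h, Matrix.smul_mulVec, Matrix.one_mulVec,
    dotProduct_smul]
  simp [dotProduct, pow_two]

lemma noisyGram_posDef {κ : Type*} [Fintype κ] [DecidableEq κ] {v : ℝ} (hv : 0 < v) (a : κ → H) :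
    (noisyGram v a).PosDef :=
  Matrix.PosDef.posSemidef_add (Matrix.posSemidef_gram ℝ a) (Matrix.PosDef.one.smul hv)

lemma ridgeCost_eq {κ : Type*} [Fintype κ] [DecidableEq κ] (v : ℝ) (a : κ → H) (x : H)
    (c : κ → ℝ) :
    ridgeCost v a x c = v + ‖x‖ ^ 2 - 2 * (c ⬝ᵥ fun i => ⟪a i, x⟫) +
      c ⬝ᵥ (noisyGram v a).mulVec c := by
  rw [dotProduct_noisyGram_mulVec, ridgeCost, norm_sub_sq_real]
  have : ⟪x, ∑ i, c i • a i⟫ = c ⬝ᵥ fun i => ⟪a i, x⟫ := by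
    rw [inner_sum]
    simp only [inner_smul_right, dotProduct, real_inner_comm]
  rw [this]
  ring

/-- The determinant of the covariance matrix of noisy readings grows by the minimal ridge
regression cost of a new vector. -/
lemma exists_det_noisyGram_sumElim {κ : Type*} [Fintype κ] [DecidableEq κ] {v : ℝ} (hv : 0 < v)
    (a : κ → H) (x : H) :
    ∃ c : κ → ℝ, (noisyGram v (Sum.elim a fun _ : Unit => x)).det =
      (noisyGram v a).det * ridgeCost v a x c ∧ ∀ c', ridgeCost v a x c ≤ ridgeCost v a x c' := by
  set K := noisyGram v a with hK
  have hKpos : K.PosDef := noisyGram_posDef hv a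
  set k : κ → ℝ := fun i => ⟪a i, x⟫ with hk
  have hunit : IsUnit K := hKpos.isUnit
  have hdet : IsUnit K.det := (Matrix.isUnit_iff_isUnit_det K).1 hunit
  have : Invertible K := hunit.invertible
  -- The solution of the normal equations `K c = k`. Its cost `v + ‖x‖² - kᵀ K⁻¹ k` is also the
  -- Schur complement of `K` in the enlarged matrix.
  set c : κ → ℝ := K⁻¹.mulVec k with hc
  have hKc : K.mulVec c = k := by
    rw [hc, Matrix.mulVec_mulVec, Matrix.mul_nonsing_inv _ hdet, Matrix.one_mulVec]
  have hsymm : ∀ p q : κ → ℝ, p ⬝ᵥ K.mulVec q = q ⬝ᵥ K.mulVec p := by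
    intro p q
    have hT : K.transpose = K := by
      have := hKpos.isHermitian
      rwa [Matrix.IsHermitian, Matrix.conjTranspose_eq_transpose_of_trivial] at this
    rw [Matrix.dotProduct_mulVec, ← Matrix.mulVec_transpose, hT, dotProduct_comm]
  refine ⟨c, ?_, fun c' => ?_⟩
  · have hblock : noisyGram v (Sum.elim a fun _ : Unit => x) =
        Matrix.fromBlocks K (Matrix.replicateCol Unit k) (Matrix.replicateRow Unit k)
          (Matrix.of fun _ _ : Unit => v + ‖x‖ ^ 2) := by
      ext i j
      rcases i with i | i <;> rcases j with j | j
      · simp [noisyGram, hK, Matrix.gram_apply, Matrix.one_apply]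
      · simp [noisyGram, hk, Matrix.gram_apply]
      · simp [noisyGram, hk, Matrix.gram_apply, real_inner_comm]
      · simp [noisyGram, Matrix.gram_apply, add_comm]
    rw [hblock, Matrix.det_fromBlocks₁₁]
    congr 1
    rw [Matrix.det_unique]
    rw [ridgeCost_eq, ← hK, hKc]
    have h1 : (Matrix.replicateRow Unit k * ⅟K * Matrix.replicateCol Unit k) () () = c ⬝ᵥ k := by
      rw [Matrix.mul_assoc, Matrix.invOf_eq_nonsing_inv, dotProduct_comm, hc]
      simp [Matrix.mul_apply, Matrix.mulVec, dotProduct]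
    have h2 : (default : Unit) = () := rfl
    rw [Matrix.sub_apply, h2, h1]
    simp only [Matrix.of_apply, ← hk]
    ring
  · rw [ridgeCost_eq, ridgeCost_eq, ← hK, ← hk, hKc]
    -- Completing the square: the excess cost of `c'` is the quadratic form of `K` at `c' - c`.
    have h := hKpos.posSemidef.dotProduct_mulVec_nonneg (c' - c)
    rw [star_trivial, Matrix.mulVec_sub, dotProduct_sub, sub_dotProduct, sub_dotProduct,
      hsymm c c', hKc] at h
    linarith

/-- The objective of the ridge regression of `x` on the vectors `a i`, `i ∈ T`. -/
noncomputable def ridgeOn {ι : Type*} (v : ℝ) (a : ι → H) (T : Finset ι) (x : H) (c : ι → ℝ) : ℝ :=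
  v + ‖x - ∑ i ∈ T, c i • a i‖ ^ 2 + v * ∑ i ∈ T, c i ^ 2

lemma le_ridgeOn {ι : Type*} {v : ℝ} (hv : 0 < v) (a : ι → H) (T : Finset ι) (x : H) (c : ι → ℝ) :
    v ≤ ridgeOn v a T x c := by
  have : 0 ≤ v * ∑ i ∈ T, c i ^ 2 := by positivity
  unfold ridgeOn
  nlinarith [sq_nonneg ‖x - ∑ i ∈ T, c i • a i‖]

variable {ι : Type*} [DecidableEq ι]

/-- The information (in nats) carried by noisy readings of the vectors `a i`, `i ∈ T`, when the
noise has variance `v`. -/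
noncomputable def logDetInfo (v : ℝ) (a : ι → H) (T : Finset ι) : ℝ :=
  Real.log (noisyGram v fun i : T => a i).det - T.card * Real.log v

lemma det_noisyGram_comp_equiv {κ κ' : Type*} [Fintype κ] [DecidableEq κ] [Fintype κ']
    [DecidableEq κ'] (v : ℝ) (a : κ → H) (e : κ' ≃ κ) :
    (noisyGram v (a ∘ e)).det = (noisyGram v a).det := by
  rw [← Matrix.det_submatrix_equiv_self e (noisyGram v a)]
  congr 1
  ext i j
  simp [noisyGram, Matrix.gram_apply, Matrix.one_apply]

lemma logDetInfo_empty (v : ℝ) (a : ι → H) : logDetInfo v a ∅ = 0 := by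
  simp [logDetInfo]

lemma logDetInfo_map {κ : Type*} [DecidableEq κ] (v : ℝ) (a : κ → H) (f : ι ↪ κ) (T : Finset ι) :
    logDetInfo v a (T.map f) = logDetInfo v (a ∘ f) T := by
  unfold logDetInfo
  rw [Finset.card_map]
  congr 2
  have hbij : Function.Bijective
      (fun i : T => (⟨f i, Finset.mem_map_of_mem f i.2⟩ : {j // j ∈ T.map f})) := by
    refine ⟨fun i j h => Subtype.ext (f.injective (by simpa using h)), fun ⟨j, hj⟩ => ?_⟩
    obtain ⟨i, hi, rfl⟩ := Finset.mem_map.1 hj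
    exact ⟨⟨i, hi⟩, rfl⟩
  exact (det_noisyGram_comp_equiv v (fun i : T.map f => a i) (Equiv.ofBijective _ hbij)).symm

/-- Adding a reading adds the logarithm of the minimal ridge regression cost, relative to the noise
variance. -/
lemma exists_logDetInfo_insert {v : ℝ} (hv : 0 < v) (a : ι → H) {T : Finset ι} {x : ι}
    (hx : x ∉ T) :
    ∃ c : ι → ℝ, logDetInfo v a (insert x T) =
        logDetInfo v a T + Real.log (ridgeOn v a T (a x) c / v) ∧
      ∀ c', ridgeOn v a T (a x) c ≤ ridgeOn v a T (a x) c' := by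
  obtain ⟨c, hc, hmin⟩ := exists_det_noisyGram_sumElim hv (fun i : T => a i) (a x)
  have hridge : ∀ d : ι → ℝ, ridgeOn v a T (a x) d =
      ridgeCost v (fun i : T => a i) (a x) fun i : T => d i := by
    intro d
    rw [ridgeOn, ridgeCost, ← Finset.sum_coe_sort T, ← Finset.sum_coe_sort T]
  set d : ι → ℝ := fun i => if h : i ∈ T then c ⟨i, h⟩ else 0 with hd
  have hdc : (fun i : T => d i) = c := by
    ext i
    simp [hd]
  refine ⟨d, ?_, fun c' => ?_⟩
  · set e : T ⊕ Unit ≃ {i // i ∈ insert x T} :=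
      ((Finset.subtypeInsertEquivOption hx).trans (Equiv.optionEquivSumPUnit _)).symm with he
    have hcomp : (fun i : {i // i ∈ insert x T} => a i) ∘ e =
        Sum.elim (fun i : T => a i) fun _ : Unit => a x := by
      ext i
      rcases i with i | i <;> simp [he, Finset.subtypeInsertEquivOption]
    have hdet := det_noisyGram_comp_equiv v (fun i : {i // i ∈ insert x T} => a i) e
    rw [hcomp, hc, ← hdc, ← hridge] at hdet
    have h1 : 0 < (noisyGram v fun i : T => a i).det := (noisyGram_posDef hv _).det_pos
    have h2 : 0 < ridgeOn v a T (a x) d := by unfold ridgeOn; positivity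
    unfold logDetInfo
    rw [← hdet, Real.log_mul h1.ne' h2.ne', Real.log_div h2.ne' hv.ne',
      Finset.card_insert_of_notMem hx]
    push_cast
    ring
  · rw [hridge, hridge, hdc]
    exact hmin _

lemma logDetInfo_le_insert {v : ℝ} (hv : 0 < v) (a : ι → H) (T : Finset ι) (x : ι) :
    logDetInfo v a T ≤ logDetInfo v a (insert x T) := by
  by_cases hx : x ∈ T
  · rw [Finset.insert_eq_of_mem hx]
  obtain ⟨c, hc, -⟩ := exists_logDetInfo_insert hv a hx
  have := Real.log_nonneg ((one_le_div hv).2 (le_ridgeOn hv a T (a x) c))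
  linarith

lemma logDetInfo_mono {v : ℝ} (hv : 0 < v) (a : ι → H) : Monotone (logDetInfo v a) := by
  intro S T hST
  rw [← Finset.union_sdiff_of_subset hST]
  generalize T \ S = R
  induction R using Finset.induction with
  | empty => simp
  | insert x R _ ih =>
    rw [Finset.union_insert]
    exact ih.trans (logDetInfo_le_insert hv a _ x)

lemma logDetInfo_nonneg {v : ℝ} (hv : 0 < v) (a : ι → H) (T : Finset ι) : 0 ≤ logDetInfo v a T := by
  rw [← logDetInfo_empty v a]
  exact logDetInfo_mono hv a (Finset.empty_subset T)

/-- The information in noisy readings is submodular. -/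
lemma logDetInfo_submodular {v : ℝ} (hv : 0 < v) (a : ι → H) {S T : Finset ι} (hST : S ⊆ T)
    {x : ι} (hx : x ∉ T) :
    logDetInfo v a (insert x T) - logDetInfo v a T ≤
      logDetInfo v a (insert x S) - logDetInfo v a S := by
  obtain ⟨c, hc, -⟩ := exists_logDetInfo_insert hv a (fun h => hx (hST h) : x ∉ S)
  obtain ⟨d, hd, hmin⟩ := exists_logDetInfo_insert hv a hx
  -- The optimal coefficients for `S`, padded by zeros, compete in the regression on `T` at the same
  -- cost, so the minimum over `T` is no larger.
  have key : ridgeOn v a T (a x) (fun i => if i ∈ S then c i else 0) = ridgeOn v a S (a x) c := by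
    have h1 : ∑ i ∈ T, (if i ∈ S then c i else 0) • a i = ∑ i ∈ S, c i • a i := by
      rw [← Finset.sum_subset hST (by intro i _ hi; simp [hi])]
      exact Finset.sum_congr rfl fun i hi => by simp [hi]
    have h2 : ∑ i ∈ T, (if i ∈ S then c i else 0) ^ 2 = ∑ i ∈ S, c i ^ 2 := by
      rw [← Finset.sum_subset hST (by intro i _ hi; simp [hi])]
      exact Finset.sum_congr rfl fun i hi => by simp [hi]
    rw [ridgeOn, ridgeOn, h1, h2]
  have hle := hmin fun i => if i ∈ S then c i else 0
  rw [key] at hle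
  have hpos := hv.trans_le (le_ridgeOn hv a T (a x) d)
  have := Real.log_le_log (div_pos hpos hv) (div_le_div_of_nonneg_right hle hv.le)
  linarith

/-- Replacing one reading by another changes the information by an amount controlled by the
distance of the two vectors. -/
lemma logDetInfo_insert_le_of_norm_sub_le {v : ℝ} (hv : 0 < v) (a : ι → H) {T : Finset ι} {x y : ι}
    (hx : x ∉ T) (hy : y ∉ T) {B Δ : ℝ} (hxB : ‖a x‖ ≤ B) (hyB : ‖a y‖ ≤ B)
    (hΔ : ‖a x - a y‖ ≤ Δ) :
    logDetInfo v a (insert x T) ≤ logDetInfo v a (insert y T) + Real.log (1 + 2 * B * Δ / v) := by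
  obtain ⟨c, hc, hcmin⟩ := exists_logDetInfo_insert hv a hx
  obtain ⟨d, hd, hdmin⟩ := exists_logDetInfo_insert hv a hy
  have hB : 0 ≤ B := (norm_nonneg _).trans hxB
  have hΔ0 : 0 ≤ Δ := (norm_nonneg _).trans hΔ
  -- Zero coefficients bound the minimum.
  have hx0 : ridgeOn v a T (a x) c ≤ v + B ^ 2 := by
    refine (hcmin 0).trans ?_
    simp only [ridgeOn, Pi.zero_apply, zero_smul, Finset.sum_const_zero, sub_zero]
    have := pow_le_pow_left₀ (norm_nonneg _) hxB 2
    simpa using this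
  have hy0 : ridgeOn v a T (a y) d ≤ v + B ^ 2 := by
    refine (hdmin 0).trans ?_
    simp only [ridgeOn, Pi.zero_apply, zero_smul, Finset.sum_const_zero, sub_zero]
    have := pow_le_pow_left₀ (norm_nonneg _) hyB 2
    simpa using this
  have hxv := le_ridgeOn hv a T (a x) c
  have hyv := le_ridgeOn hv a T (a y) d
  set r := ridgeOn v a T (a x) c with hr
  set q := ridgeOn v a T (a y) d with hq
  -- The optimal coefficients for `a y` are tried on `a x`. For fixed coefficients the root of the
  -- cost without `v` is the norm of a pair (residual, penalty), so it moves by at most `Δ`.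
  have hsq : √(r - v) ≤ √(q - v) + Δ := by
    have hn : ‖a y - ∑ i ∈ T, d i • a i‖ ≤ √(q - v) := by
      refine Real.le_sqrt_of_sq_le ?_
      rw [hq, ridgeOn]
      have : 0 ≤ v * ∑ i ∈ T, d i ^ 2 := by positivity
      linarith
    have htri : ‖a x - ∑ i ∈ T, d i • a i‖ ≤ ‖a y - ∑ i ∈ T, d i • a i‖ + Δ := by
      have : a x - ∑ i ∈ T, d i • a i = (a y - ∑ i ∈ T, d i • a i) + (a x - a y) := by abel
      rw [this]
      exact (norm_add_le _ _).trans (by linarith)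
    rw [← Real.sqrt_sq (show 0 ≤ √(q - v) + Δ by positivity)]
    refine Real.sqrt_le_sqrt ?_
    have h1 := hcmin d
    have h2 : q - v = ‖a y - ∑ i ∈ T, d i • a i‖ ^ 2 + v * ∑ i ∈ T, d i ^ 2 := by
      rw [hq, ridgeOn]; ring
    have h3 := pow_le_pow_left₀ (norm_nonneg _) htri 2
    have h4 := Real.sq_sqrt (sub_nonneg.2 hyv)
    have h5 : r ≤ v + ‖a x - ∑ i ∈ T, d i • a i‖ ^ 2 + v * ∑ i ∈ T, d i ^ 2 := h1
    have h6 := mul_le_mul_of_nonneg_right hn hΔ0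
    nlinarith
  -- A difference of squares: the roots differ by at most `Δ` and are each at most `B`.
  have hrq : r ≤ q + 2 * B * Δ := by
    have hrs : √(r - v) ≤ B := Real.sqrt_le_iff.2 ⟨hB, by linarith⟩
    have hqs : √(q - v) ≤ B := Real.sqrt_le_iff.2 ⟨hB, by linarith⟩
    have h1 := Real.sq_sqrt (sub_nonneg.2 hxv)
    have h2 := Real.sq_sqrt (sub_nonneg.2 hyv)
    have h3 := Real.sqrt_nonneg (r - v)
    have h4 := Real.sqrt_nonneg (q - v)
    nlinarith [mul_nonneg hB hΔ0, mul_le_mul_of_nonneg_right hrs h3]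
  have hq0 := hv.trans_le hyv
  have hr0 := hv.trans_le hxv
  -- Uses `q ≥ v` to turn the additive error into a factor.
  have hratio : r / v ≤ q / v * (1 + 2 * B * Δ / v) := by
    have hnn : 0 ≤ 2 * B * Δ := by positivity
    rw [mul_add, mul_one, div_mul_div_comm, div_add_div _ _ hv.ne' (by positivity),
      div_le_div_iff₀ hv (by positivity)]
    nlinarith [mul_nonneg hv.le (mul_nonneg hv.le (sub_nonneg.2 hrq)),
      mul_nonneg hv.le (mul_nonneg hv.le (sub_nonneg.2 (mul_le_mul_of_nonneg_right hyv hnn)))]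
  have := Real.log_le_log (div_pos hr0 hv) hratio
  rw [Real.log_mul (div_pos hq0 hv).ne' (by positivity)] at this
  linarith

lemma norm_add_sq_of_inner_eq_zero {x y : H} (h : ⟪x, y⟫ = 0) :
    ‖x + y‖ ^ 2 = ‖x‖ ^ 2 + ‖y‖ ^ 2 := by
  rw [norm_add_sq_real, h]
  ring

/-- Orthogonal perturbations of the vectors, of squared norm at most `ε`, increase the information
in at most `N` readings by at most `log (1 + N ε / v)` for each reading. -/
lemma logDetInfo_add_orthogonal_le {v : ℝ} (hv : 0 < v) (a b : ι → H)
    (hab : ∀ i j, ⟪a i, b j⟫ = 0) {ε : ℝ} (hε : ∀ i, ‖b i‖ ^ 2 ≤ ε) (N : ℕ) (T : Finset ι)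
    (hT : T.card ≤ N) :
    logDetInfo v (a + b) T ≤ logDetInfo v a T + T.card * Real.log (1 + N * ε / v) := by
  induction T using Finset.induction with
  | empty => simp [logDetInfo_empty]
  | insert x T hx ih =>
    rw [Finset.card_insert_of_notMem hx] at hT ⊢
    specialize ih (by omega)
    obtain ⟨c, hc, hcmin⟩ := exists_logDetInfo_insert hv (a + b) hx
    obtain ⟨d, hd, -⟩ := exists_logDetInfo_insert hv a hx
    have hε0 : 0 ≤ ε := (sq_nonneg _).trans (hε x)
    set q := ridgeOn v a T (a x) d with hq
    have hqv := le_ridgeOn hv a T (a x) d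
    have hD0 : 0 ≤ ∑ i ∈ T, d i ^ 2 := by positivity
    have hvD : v + v * ∑ i ∈ T, d i ^ 2 ≤ q := by
      rw [hq, ridgeOn]
      nlinarith [sq_nonneg ‖a x - ∑ i ∈ T, d i • a i‖]
    have htail : ‖b x - ∑ i ∈ T, d i • b i‖ ^ 2 ≤ N * ε * (1 + ∑ i ∈ T, d i ^ 2) := by
      have hsqrt : ∀ i, ‖b i‖ ≤ √ε := fun i => Real.le_sqrt_of_sq_le (hε i)
      have h1 : ‖b x - ∑ i ∈ T, d i • b i‖ ≤ √ε * (1 + ∑ i ∈ T, |d i|) := by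
        calc ‖b x - ∑ i ∈ T, d i • b i‖ ≤ ‖b x‖ + ∑ i ∈ T, ‖d i • b i‖ :=
              (norm_sub_le _ _).trans (add_le_add_right (norm_sum_le _ _) _)
          _ ≤ √ε + ∑ i ∈ T, |d i| * √ε := by
              refine add_le_add (hsqrt x) (Finset.sum_le_sum fun i _ => ?_)
              rw [norm_smul, Real.norm_eq_abs]
              exact mul_le_mul_of_nonneg_left (hsqrt i) (abs_nonneg _)
          _ = √ε * (1 + ∑ i ∈ T, |d i|) := by rw [← Finset.sum_mul]; ring
      have h2 := pow_le_pow_left₀ (norm_nonneg _) h1 2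
      rw [mul_pow, Real.sq_sqrt hε0] at h2
      -- Cauchy–Schwarz over `insert x T`, with weight `1` at `x`; this set has at most `N`
      -- elements.
      have h3 : (1 + ∑ i ∈ T, |d i|) ^ 2 ≤ N * (1 + ∑ i ∈ T, d i ^ 2) := by
        have hcs := sq_sum_le_card_mul_sum_sq (s := insert x T)
          (f := fun i => if i = x then 1 else |d i|)
        rw [Finset.sum_insert hx, Finset.sum_insert hx, Finset.card_insert_of_notMem hx] at hcs
        have e1 : ∑ i ∈ T, (if i = x then (1 : ℝ) else |d i|) = ∑ i ∈ T, |d i| :=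
          Finset.sum_congr rfl fun i hi => by rw [if_neg (by rintro rfl; exact hx hi)]
        have e2 : ∑ i ∈ T, (if i = x then (1 : ℝ) else |d i|) ^ 2 = ∑ i ∈ T, d i ^ 2 :=
          Finset.sum_congr rfl fun i hi => by
            rw [if_neg (by rintro rfl; exact hx hi), sq_abs]
        rw [e1, e2] at hcs
        simp only [if_true, one_pow] at hcs
        refine hcs.trans (mul_le_mul_of_nonneg_right (by exact_mod_cast hT) (by positivity))
      calc _ ≤ _ := h2
        _ ≤ ε * (N * (1 + ∑ i ∈ T, d i ^ 2)) := mul_le_mul_of_nonneg_left h3 hε0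
        _ = _ := by ring
    -- Pythagoras: the residuals in `a` and in `b` are orthogonal.
    have hfull : ridgeOn v (a + b) T ((a + b) x) d = q + ‖b x - ∑ i ∈ T, d i • b i‖ ^ 2 := by
      have hsplit : (a + b) x - ∑ i ∈ T, d i • (a + b) i =
          (a x - ∑ i ∈ T, d i • a i) + (b x - ∑ i ∈ T, d i • b i) := by
        simp only [Pi.add_apply, smul_add, Finset.sum_add_distrib]
        abel
      have horth : ⟪a x - ∑ i ∈ T, d i • a i, b x - ∑ i ∈ T, d i • b i⟫ = 0 := by
        simp [inner_sub_left, inner_sub_right, inner_sum, sum_inner, inner_smul_left,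
          inner_smul_right, hab]
      rw [ridgeOn, hsplit, norm_add_sq_of_inner_eq_zero horth, hq, ridgeOn]
      ring
    have hle := hcmin d
    rw [hfull] at hle
    have hr0 := hv.trans_le (le_ridgeOn hv (a + b) T ((a + b) x) c)
    have hq0 := hv.trans_le hqv
    -- The penalty keeps the coefficients small: `v (1 + ∑ d²) ≤ q`, so the tail is at most `N ε /
    -- v` times `q`.
    have hratio : ridgeOn v (a + b) T ((a + b) x) c / v ≤ q / v * (1 + N * ε / v) := by
      have h1 : N * ε * (1 + ∑ i ∈ T, d i ^ 2) ≤ N * ε / v * q := by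
        have h2 := mul_le_mul_of_nonneg_left hvD (show 0 ≤ N * ε / v by positivity)
        refine le_trans (le_of_eq ?_) h2
        field_simp
      rw [div_mul_eq_mul_div]
      refine div_le_div_of_nonneg_right ?_ hv.le
      linarith
    have := Real.log_le_log (div_pos hr0 hv) hratio
    rw [Real.log_mul (div_pos hq0 hv).ne' (by positivity)] at this
    push_cast
    linarith

end RidgeRegression

/-! ### Greedy maximization of monotone submodular functions -/

section Greedy

lemma GreedyRun.subset {G : Finset ℝ → ℝ} {V S : Finset ℝ} {n : ℕ} (h : GreedyRun G V n S) :
    S ⊆ V := by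
  induction h with
  | zero => exact Finset.empty_subset V
  | step _ hx _ ih => exact Finset.insert_subset (Finset.mem_sdiff.1 hx).1 ih

lemma GreedyRun.card_eq {G : Finset ℝ → ℝ} {V S : Finset ℝ} {n : ℕ} (h : GreedyRun G V n S) :
    S.card = n := by
  induction h with
  | zero => rfl
  | step _ hx _ ih => rw [Finset.card_insert_of_notMem (Finset.mem_sdiff.1 hx).2, ih]

/-- For a submodular function, the gain of a union is at most the sum of the single gains. -/
lemma le_add_sum_gain_of_submodular {ι : Type*} [DecidableEq ι] {G : Finset ι → ℝ}
    (hsub : ∀ S T : Finset ι, S ⊆ T → ∀ x ∉ T, G (insert x T) - G T ≤ G (insert x S) - G S)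
    (S R : Finset ι) (hR : Disjoint R S) :
    G (S ∪ R) ≤ G S + ∑ y ∈ R, (G (insert y S) - G S) := by
  induction R using Finset.induction with
  | empty => simp
  | insert x R hx ih =>
    rw [Finset.disjoint_insert_left] at hR
    have h := hsub S (S ∪ R) Finset.subset_union_left x (by simp [hR.1, hx])
    rw [Finset.union_insert, Finset.sum_insert hx]
    linarith [ih hR.2]

/-- The gap between a greedy solution and any competitor shrinks geometrically. -/
lemma GreedyRun.sub_le {G : Finset ℝ → ℝ} (hmono : Monotone G)
    (hsub : ∀ S T : Finset ℝ, S ⊆ T → ∀ x ∉ T, G (insert x T) - G T ≤ G (insert x S) - G S)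
    {V S T : Finset ℝ} {n N : ℕ} (h : GreedyRun G V n S) (hT : T ⊆ V) (hN : 0 < N)
    (hcard : T.card ≤ N) :
    G T - G S ≤ (1 - 1 / (N : ℝ)) ^ n * (G T - G ∅) := by
  have hN' : (1 : ℝ) ≤ N := by exact_mod_cast hN
  have hfac : 0 ≤ 1 - 1 / (N : ℝ) := by
    rw [sub_nonneg, div_le_one (by linarith)]
    exact hN'
  induction h with
  | zero => simp
  | @step n S x _ hx hmax ih =>
    have hgain : 0 ≤ G (insert x S) - G S := sub_nonneg.2 (hmono (Finset.subset_insert x S))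
    -- The at most `N` missing elements of `T` each gain no more than the greedy choice. Hence one
    -- round closes at least a fraction `1 / N` of the gap.
    have h1 : G T ≤ G S + N * (G (insert x S) - G S) := by
      calc G T ≤ G (S ∪ T \ S) := hmono (by simp)
        _ ≤ G S + ∑ y ∈ T \ S, (G (insert y S) - G S) :=
            le_add_sum_gain_of_submodular hsub S (T \ S) Finset.sdiff_disjoint
        _ ≤ G S + ∑ _y ∈ T \ S, (G (insert x S) - G S) := by
            gcongr with y hy
            exact hmax y (Finset.sdiff_subset_sdiff hT subset_rfl hy)
        _ ≤ G S + N * (G (insert x S) - G S) := by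
            rw [Finset.sum_const, nsmul_eq_mul]
            have : ((T \ S).card : ℝ) ≤ N := by
              exact_mod_cast (Finset.card_le_card Finset.sdiff_subset).trans hcard
            gcongr
    have h2 : (G T - G S) / N ≤ G (insert x S) - G S := by
      rw [div_le_iff₀ (by linarith)]
      linarith
    have h3 := mul_le_mul_of_nonneg_left ih hfac
    rw [pow_succ']
    have h4 : (1 - 1 / (N : ℝ)) * (G T - G S) = (G T - G S) - (G T - G S) / N := by ring
    linarith

/-- The greedy algorithm attains a fraction `1 - 1 / e` of the maximum of a monotone submodular
function. -/
lemma GreedyRun.one_sub_exp_mul_le {G : Finset ℝ → ℝ} (hmono : Monotone G)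
    (hsub : ∀ S T : Finset ℝ, S ⊆ T → ∀ x ∉ T, G (insert x T) - G T ≤ G (insert x S) - G S)
    (hempty : G ∅ = 0) {V S T : Finset ℝ} {N : ℕ} (h : GreedyRun G V N S) (hT : T ⊆ V)
    (hN : 0 < N) (hcard : T.card ≤ N) :
    (1 - 1 / Real.exp 1) * G T ≤ G S := by
  have h1 := h.sub_le hmono hsub hT hN hcard
  have hT0 : 0 ≤ G T := hempty ▸ hmono (Finset.empty_subset T)
  have h2 : (1 - 1 / (N : ℝ)) ^ N ≤ 1 / Real.exp 1 := by
    have := Real.one_sub_div_pow_le_exp_neg (n := N) (t := 1) (by exact_mod_cast hN)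
    rwa [Real.exp_neg, ← one_div] at this
  rw [hempty, sub_zero] at h1
  nlinarith [mul_le_mul_of_nonneg_right h2 hT0]

/-- With a single round, the greedy algorithm attains the maximum. -/
lemma GreedyRun.le_of_one {G : Finset ℝ → ℝ} {V S : Finset ℝ} (h : GreedyRun G V 1 S) {x : ℝ}
    (hx : x ∈ V) : G {x} ≤ G S := by
  cases h with
  | step h0 _ hmax =>
    cases h0 with
    | zero => simpa using hmax x (by simpa using hx)

end Greedy

/-! ### Moving sensors to distinct grid points -/

section Grid

/-- A point of the aperture is near a grid point outside of any given small set. -/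
lemma IsUniformGrid.exists_near_notMem {A : Set ℝ} {δ : ℝ} (hδ : 0 < δ) {V : Finset ℝ}
    (hV : IsUniformGrid A δ V) {U : Finset ℝ} (hU : U.card < V.card) {x : ℝ} (hx : x ∈ A) :
    ∃ y ∈ V, y ∉ U ∧ |x - y| ≤ (U.card + 1) * δ := by
  obtain ⟨x₀, K, hVK, -, hnear⟩ := hV
  obtain ⟨z, hz, hxz⟩ := hnear x hx
  have hK : V.card ≤ K := by
    rw [hVK]
    exact Finset.card_image_le.trans (by simp)
  rw [hVK, Finset.mem_image] at hz
  obtain ⟨k, hk, rfl⟩ := hz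
  rw [Finset.mem_range] at hk
  -- The indices `b, …, b + U.card` form a window inside the grid that contains `k`. It has one
  -- point more than `U`, so some point of it is free and at most `U.card` steps from `k`.
  obtain ⟨b, hbk, hkb, hbK⟩ : ∃ b, b ≤ k ∧ k ≤ b + U.card ∧ b + U.card < K :=
    ⟨min k (K - 1 - U.card), by omega, by omega, by omega⟩
  have hinj : Function.Injective fun i : ℕ => x₀ + ((b + i : ℕ) : ℝ) * δ := by
    intro i j hij
    simp only [add_right_inj, mul_eq_mul_right_iff, hδ.ne', or_false, Nat.cast_inj] at hij
    exact hij
  obtain ⟨y, hy, hyU⟩ := Finset.exists_mem_notMem_of_card_lt_card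
    (s := U) (t := (Finset.range (U.card + 1)).image fun i : ℕ => x₀ + ((b + i : ℕ) : ℝ) * δ)
    (by rw [Finset.card_image_of_injective _ hinj]; simp)
  obtain ⟨i, hi, rfl⟩ := Finset.mem_image.1 hy
  rw [Finset.mem_range] at hi
  refine ⟨_, ?_, hyU, ?_⟩
  · rw [hVK]
    exact Finset.mem_image.2 ⟨b + i, Finset.mem_range.2 (by omega), rfl⟩
  · have h1 : |(k : ℝ) - ((b + i : ℕ) : ℝ)| ≤ U.card := by
      rw [abs_le]
      constructor
      · have : ((b + i : ℕ) : ℝ) ≤ ((k + U.card : ℕ) : ℝ) := by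
          exact_mod_cast (by omega : b + i ≤ k + U.card)
        push_cast at this ⊢
        linarith
      · have : (k : ℝ) ≤ ((b + i + U.card : ℕ) : ℝ) := by
          exact_mod_cast (by omega : k ≤ b + i + U.card)
        push_cast at this ⊢
        linarith
    have h2 : x₀ + (k : ℝ) * δ - (x₀ + ((b + i : ℕ) : ℝ) * δ) = (k - ((b + i : ℕ) : ℝ)) * δ := by
      ring
    have h3 := abs_sub_le x (x₀ + (k : ℝ) * δ) (x₀ + ((b + i : ℕ) : ℝ) * δ)
    rw [h2, abs_mul, abs_of_pos hδ] at h3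
    nlinarith [mul_le_mul_of_nonneg_right h1 hδ.le]

variable {H : Type*} [NormedAddCommGroup H] [InnerProductSpace ℝ H]

/-- Moving the sensors of `S` one by one to free grid points, when the grid points in `U` are
already occupied. -/
lemma IsUniformGrid.exists_logDetInfo_disjSum_le {A : Set ℝ} {δ : ℝ} (hδ : 0 < δ) {V : Finset ℝ}
    (hV : IsUniformGrid A δ V) {v : ℝ} (hv : 0 < v) (a : ℝ → H) {B L : ℝ} (hL : 0 ≤ L)
    (haB : ∀ x, ‖a x‖ ≤ B) (haL : ∀ x y, ‖a x - a y‖ ≤ L * |x - y|)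
    (S : Finset ℝ) (hS : (S : Set ℝ) ⊆ A) (U : Finset ℝ) (hU : U ⊆ V)
    (hcard : S.card + U.card ≤ V.card) :
    ∃ S' ⊆ V, S'.card = S.card + U.card ∧
      logDetInfo v (Sum.elim a a) (S.disjSum U) ≤ logDetInfo v a S' +
        ∑ i ∈ Finset.range S.card, Real.log (1 + 2 * B * L * δ / v * (U.card + i + 1)) := by
  -- Unmoved sensors and occupied grid points are indexed by a disjoint sum because their positions
  -- may coincide, yet they count as separate readings with separate noise. Each move adds one point
  -- to `U`, which lengthens the bound for the next move by `δ`.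
  induction S using Finset.induction generalizing U with
  | empty =>
    refine ⟨U, hU, by simp, ?_⟩
    rw [Finset.empty_disjSum, logDetInfo_map]
    simp [Function.comp_def]
  | insert x S hx ih =>
    rw [Finset.card_insert_of_notMem hx] at hcard
    obtain ⟨y, hyV, hyU, hxy⟩ := hV.exists_near_notMem hδ (U := U) (by omega)
      (hS (Finset.mem_coe.2 (Finset.mem_insert_self x S)))
    obtain ⟨S', hS'V, hS', hle⟩ := ih ((Finset.coe_subset.2 (Finset.subset_insert x S)).trans hS)
      (insert y U) (Finset.insert_subset hyV hU)
      (by rw [Finset.card_insert_of_notMem hyU]; omega)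
    rw [Finset.card_insert_of_notMem hyU] at hS' hle
    have e1 : (insert x S).disjSum U = insert (Sum.inl x) (S.disjSum U) := by
      ext z; rcases z with z | z <;> simp
    have e2 : S.disjSum (insert y U) = insert (Sum.inr y) (S.disjSum U) := by
      ext z; rcases z with z | z <;> simp
    have hswap := logDetInfo_insert_le_of_norm_sub_le hv (Sum.elim a a) (T := S.disjSum U)
      (x := Sum.inl x) (y := Sum.inr y) (by simpa using hx) (by simpa using hyU)
      (haB x) (haB y) ((haL x y).trans (mul_le_mul_of_nonneg_left hxy hL))
    refine ⟨S', hS'V, by rw [hS', Finset.card_insert_of_notMem hx]; ring, ?_⟩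
    rw [Finset.card_insert_of_notMem hx, Finset.sum_range_succ', e1]
    rw [e2] at hle
    have e3 : ∀ i : ℕ, ((U.card + 1 : ℕ) : ℝ) + i + 1 = (U.card : ℝ) + ((i + 1 : ℕ) : ℝ) + 1 := by
      intro i; push_cast; ring
    simp only [e3] at hle
    have e4 : 1 + 2 * B * L * δ / v * (U.card + ((0 : ℕ) : ℝ) + 1) =
        1 + 2 * B * (L * ((U.card + 1) * δ)) / v := by
      push_cast; ring
    rw [e4]
    linarith

/-- The information in the readings at `S` is nearly attained on the grid. -/
lemma IsUniformGrid.exists_logDetInfo_le {A : Set ℝ} {δ : ℝ} (hδ : 0 < δ) {V : Finset ℝ}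
    (hV : IsUniformGrid A δ V) {v : ℝ} (hv : 0 < v) (a : ℝ → H) {B L : ℝ} (hL : 0 ≤ L)
    (haB : ∀ x, ‖a x‖ ≤ B) (haL : ∀ x y, ‖a x - a y‖ ≤ L * |x - y|)
    (S : Finset ℝ) (hS : (S : Set ℝ) ⊆ A) (hcard : S.card ≤ V.card) :
    ∃ S' ⊆ V, S'.card = S.card ∧ logDetInfo v a S ≤ logDetInfo v a S' +
        ∑ i ∈ Finset.range S.card, Real.log (1 + 2 * B * L * δ / v * (i + 1)) := by
  obtain ⟨S', hS'V, hS', hle⟩ := hV.exists_logDetInfo_disjSum_le hδ hv a hL haB haL S hS ∅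
    (Finset.empty_subset V) (by simpa using hcard)
  refine ⟨S', hS'V, by simpa using hS', ?_⟩
  rw [Finset.disjSum_empty, logDetInfo_map] at hle
  simpa [Function.comp_def] using hle

/-- By concavity of the logarithm. -/
lemma sum_log_one_add_mul_le {κ : ℝ} (hκ : 0 ≤ κ) (n : ℕ) :
    ∑ i ∈ Finset.range n, Real.log (1 + κ * (i + 1)) ≤ n * Real.log (1 + κ * ((n + 1) / 2)) := by
  set m : ℝ := 1 + κ * ((n + 1) / 2) with hm
  have hm0 : 0 < m := by positivity
  -- The tangent to the logarithm at the mean `m` of the arguments; its linear terms sum to zero.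
  have h1 : ∀ i ∈ Finset.range n, Real.log (1 + κ * ((i : ℝ) + 1)) ≤
      Real.log m + ((1 + κ * ((i : ℝ) + 1)) / m - 1) := by
    intro i _
    have hi : 0 < 1 + κ * ((i : ℝ) + 1) := by positivity
    have := Real.log_le_sub_one_of_pos (div_pos hi hm0)
    rw [Real.log_div hi.ne' hm0.ne'] at this
    linarith
  have hsum : ∑ i ∈ Finset.range n, (1 + κ * ((i : ℝ) + 1)) = n * m := by
    rw [hm]
    clear h1 hm0 hm m
    induction n with
    | zero => simp
    | succ n ih => rw [Finset.sum_range_succ, ih]; push_cast; ring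
  refine (Finset.sum_le_sum h1).trans (le_of_eq ?_)
  rw [Finset.sum_add_distrib, Finset.sum_sub_distrib, ← Finset.sum_div, hsum]
  simp [hm0.ne']

end Grid

/-! ### Greedy choice on the grid against arbitrary positions -/

section GreedyBound

variable {H : Type*} [NormedAddCommGroup H] [InnerProductSpace ℝ H]

lemma logDetInfo_singleton {ι : Type*} [DecidableEq ι] {v : ℝ} (hv : 0 < v) (a : ι → H) (x : ι) :
    logDetInfo v a {x} = Real.log (1 + ‖a x‖ ^ 2 / v) := by
  obtain ⟨c, hc, -⟩ := exists_logDetInfo_insert hv a (Finset.notMem_empty x)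
  rw [logDetInfo_empty] at hc
  rw [← insert_empty_eq, hc, ridgeOn]
  simp [add_div, hv.ne']

/-- A rational number just below `e / (e - 1)`, to serve as the exponent that the factor `1 - 1 / e`
can absorb. -/
lemma rat_le_inv_one_sub_inv_exp : (1.5819 : ℝ) * (1 - 1 / Real.exp 1) ≤ 1 := by
  have he := Real.exp_one_lt_d9
  have hp := Real.exp_pos 1
  have : (1.5819 / 0.5819)⁻¹ ≤ 1 / Real.exp 1 := by
    rw [← one_div]
    exact one_div_le_one_div_of_le hp (by norm_num; linarith)
  norm_num at this ⊢
  linarith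

/-- The information in a single reading, when the reading is moved a little. -/
lemma one_sub_exp_mul_log_le {u c c' r : ℝ} (hu : 0 ≤ u) (hc1 : c ≤ 1) (hc0 : 0 ≤ c)
    (hr : 0 ≤ r) (hcc' : c ≤ c' + Real.pi / 4 * r) :
    (1 - 1 / Real.exp 1) * (Real.log (1 + u * c ^ 2) - Real.log (1 + u * r)) ≤
      Real.log (1 + u * c' ^ 2) := by
  have hq := rat_le_inv_one_sub_inv_exp
  have he2 : (2 : ℝ) < Real.exp 1 := by linarith [Real.exp_one_gt_d9]
  have hq0 : 0 ≤ 1 - 1 / Real.exp 1 := by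
    rw [sub_nonneg, div_le_one (by positivity)]
    linarith
  have hlog' : 0 ≤ Real.log (1 + u * c' ^ 2) :=
    Real.log_nonneg (le_add_of_nonneg_right (by positivity))
  have hpi := Real.pi_lt_d4
  have hpi0 := Real.pi_pos
  have key : c ^ 2 ≤ r + 1.5819 * c' ^ 2 := by
    by_cases hcr : c ^ 2 ≤ r
    · nlinarith [sq_nonneg c']
    push Not at hcr
    have hk : Real.pi / 4 * r ≤ 0.7854 * r := mul_le_mul_of_nonneg_right (by linarith) hr
    have hrc : r ≤ c := by nlinarith
    have h1 : 0 ≤ c - 0.7854 * r := by linarith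
    have h2 : (c - 0.7854 * r) ^ 2 ≤ c' ^ 2 := pow_le_pow_left₀ h1 (by linarith) 2
    have h3 : c * r ≤ r := by nlinarith
    -- After `r` is replaced by the smaller `c r`, the claim is the nonnegativity of a quadratic
    -- form in `c` and `r` with negative discriminant. The constant `0.7854` slightly exceeds `π /
    -- 4`.
    nlinarith [sq_nonneg (0.5819 * 2 * c - 1.4848 * r), sq_nonneg r]
  have hlog : Real.log (1 + u * c ^ 2) ≤
      Real.log (1 + u * r) + 1.5819 * Real.log (1 + u * c' ^ 2) := by
    -- Bernoulli's inequality moves the constant into the exponent, hence in front of the logarithm.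
    have hb : 1 + 1.5819 * (u * c' ^ 2) ≤ (1 + u * c' ^ 2) ^ (1.5819 : ℝ) :=
      one_add_mul_self_le_rpow_one_add
        (by linarith [show 0 ≤ u * c' ^ 2 by positivity]) (by norm_num)
    have hle : 1 + u * c ^ 2 ≤ (1 + u * r) * (1 + u * c' ^ 2) ^ (1.5819 : ℝ) := by
      have h1 : 0 ≤ u * r := by positivity
      have h2 : 0 ≤ u * c' ^ 2 := by positivity
      have h3 := mul_le_mul_of_nonneg_left hb (by linarith : 0 ≤ 1 + u * r)
      have h4 := mul_le_mul_of_nonneg_left key hu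
      nlinarith [mul_nonneg h1 h2]
    have := Real.log_le_log (by positivity) hle
    rwa [Real.log_mul (by positivity) (by positivity), Real.log_rpow (by positivity)] at this
  calc _ ≤ (1 - 1 / Real.exp 1) * (1.5819 * Real.log (1 + u * c' ^ 2)) :=
        mul_le_mul_of_nonneg_left (by linarith) hq0
    _ = (1.5819 * (1 - 1 / Real.exp 1)) * Real.log (1 + u * c' ^ 2) := by ring
    _ ≤ 1 * Real.log (1 + u * c' ^ 2) := mul_le_mul_of_nonneg_right hq hlog'
    _ = _ := one_mul _

/-- Compares the mean displacement loss with the stated `N ^ (3 / 2)` term. It fails for `N = 1`,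
where `2 π > 4`; hence the separate treatment of a single sensor. -/
lemma pi_mul_add_one_le_rpow {N : ℕ} (hN : 2 ≤ N) :
    Real.pi * (N + 1) ≤ 4 * (N : ℝ) ^ (3 / 2 : ℝ) := by
  have hN' : (2 : ℝ) ≤ N := by exact_mod_cast hN
  have h1 : (N : ℝ) ^ (3 / 2 : ℝ) = N * √N := by
    rw [show (3 / 2 : ℝ) = 1 + 1 / 2 by norm_num, Real.rpow_add (by linarith), Real.rpow_one,
      Real.sqrt_eq_rpow]
  have h2 : (1.4 : ℝ) ≤ √N := Real.le_sqrt_of_sq_le (by norm_num; linarith)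
  rw [h1]
  nlinarith [Real.pi_lt_d4, mul_le_mul_of_nonneg_left h2 (by linarith : (0 : ℝ) ≤ N)]

/-- The greedy algorithm on a grid, compared with arbitrary sensor positions in the aperture. -/
lemma GreedyRun.one_sub_exp_mul_sub_le {A : Set ℝ} {δ : ℝ} (hδ : 0 < δ) {V : Finset ℝ}
    (hV : IsUniformGrid A δ V) {v : ℝ} (hv : 0 < v) {P lam : ℝ} (hP : 0 ≤ P) (hlam : 0 < lam)
    (a : ℝ → H) (haB : ∀ x, ‖a x‖ ≤ √P)
    (haL : ∀ x y, ‖a x - a y‖ ≤ √P * (Real.pi / lam) * |x - y|)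
    {N : ℕ} {Sgr : Finset ℝ} (hgr : GreedyRun (logDetInfo v a) V N Sgr)
    (S : Finset ℝ) (hS : (S : Set ℝ) ⊆ A) (hcard : S.card ≤ N) :
    (1 - 1 / Real.exp 1) * (logDetInfo v a S -
        N * Real.log (1 + 4 * δ * P * (1 + δ) * (N : ℝ) ^ (3 / 2 : ℝ) / (lam * v))) ≤
      logDetInfo v a Sgr := by
  have he2 : (2 : ℝ) < Real.exp 1 := by linarith [Real.exp_one_gt_d9]
  have hq0 : 0 ≤ 1 - 1 / Real.exp 1 := by
    rw [sub_nonneg, div_le_one (by positivity)]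
    linarith
  -- A run of `N` rounds selects `N` distinct grid points, so the grid has room for every
  -- competitor.
  have hSgr : Sgr.card ≤ V.card := Finset.card_le_card hgr.subset
  rw [hgr.card_eq] at hSgr
  have hgr0 := logDetInfo_nonneg hv a Sgr
  have hlog0 : 0 ≤
      Real.log (1 + 4 * δ * P * (1 + δ) * (N : ℝ) ^ (3 / 2 : ℝ) / (lam * v)) :=
    Real.log_nonneg (le_add_of_nonneg_right (by positivity))
  rcases S.eq_empty_or_nonempty with rfl | hne
  · rw [logDetInfo_empty, zero_sub]
    exact (mul_nonpos_of_nonneg_of_nonpos hq0 (neg_nonpos.2 (by positivity))).trans hgr0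
  obtain ⟨x, hx⟩ := hne
  have hN : 0 < N := (Finset.card_pos.2 ⟨x, hx⟩).trans_le hcard
  rcases (show N = 1 ∨ 2 ≤ N by omega) with rfl | hN2
  · obtain ⟨z, rfl⟩ : ∃ z, S = {z} :=
      Finset.card_eq_one.1 (le_antisymm hcard (Finset.card_pos.2 ⟨x, hx⟩))
    obtain ⟨y, hyV, -, hzy⟩ := hV.exists_near_notMem hδ (U := ∅) (by simpa using hSgr)
      (hS (by simp) : z ∈ A)
    refine le_trans ?_ (hgr.le_of_one hyV)
    rw [logDetInfo_singleton hv, logDetInfo_singleton hv]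
    -- Norms are normalized by `√P` below, so zero power is set aside.
    rcases hP.eq_or_lt with rfl | hP0
    · have h0 : ∀ w, ‖a w‖ = 0 := fun w => le_antisymm (by simpa using haB w) (norm_nonneg _)
      simp [h0]
    have hsP : 0 < √P := Real.sqrt_pos.2 hP0
    -- With `r = 4 δ / λ`, the normalized displacement bound `π δ / λ` is `π / 4 * r`, while `u * r`
    -- is the stated loss without the factor `1 + δ`.
    have hmain := one_sub_exp_mul_log_le (u := P / v) (c := ‖a z‖ / √P) (c' := ‖a y‖ / √P)
      (r := 4 * δ / lam) (by positivity) ((div_le_one hsP).2 (haB z)) (by positivity)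
      (by positivity) (by
        have h1 : ‖a z‖ ≤ ‖a y‖ + √P * (Real.pi / lam) * δ := by
          have h2 := norm_le_norm_add_norm_sub' (a z) (a y)
          have h3 : √P * (Real.pi / lam) * |z - y| ≤ √P * (Real.pi / lam) * δ :=
            mul_le_mul_of_nonneg_left (by simpa using hzy) (by positivity)
          linarith [haL z y]
        rw [div_le_iff₀ hsP, add_mul, div_mul_cancel₀ _ hsP.ne']
        refine h1.trans (le_of_eq ?_)
        field_simp)
    have h1 : ∀ w, P / v * (‖a w‖ / √P) ^ 2 = ‖a w‖ ^ 2 / v := by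
      intro w
      rw [div_pow, Real.sq_sqrt hP]
      field_simp
    rw [h1, h1] at hmain
    refine le_trans (mul_le_mul_of_nonneg_left ?_ hq0) hmain
    rw [Nat.cast_one, Real.one_rpow, one_mul, mul_one]
    refine sub_le_sub_left (Real.log_le_log (by positivity) (add_le_add_right ?_ _)) _
    rw [div_mul_div_comm, mul_comm v lam]
    refine div_le_div_of_nonneg_right ?_ (by positivity)
    nlinarith [mul_nonneg (mul_nonneg hδ.le hP) hδ.le]
  · obtain ⟨S', hS'V, hS', hle⟩ := hV.exists_logDetInfo_le hδ hv a (B := √P)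
      (L := √P * (Real.pi / lam)) (by positivity) haB haL S hS (hcard.trans hSgr)
    have hgreedy := hgr.one_sub_exp_mul_le (logDetInfo_mono hv a)
      (fun S T hST x hx => logDetInfo_submodular hv a hST hx) (logDetInfo_empty v a) hS'V hN
      (hS'.trans_le hcard)
    refine le_trans (mul_le_mul_of_nonneg_left ?_ hq0) hgreedy
    have hκ : 0 ≤ 2 * √P * (√P * (Real.pi / lam)) * δ / v := by positivity
    have hsum := sum_log_one_add_mul_le hκ S.card
    have hcard' : (S.card : ℝ) ≤ N := by exact_mod_cast hcard
    have hlast : S.card * Real.log (1 + 2 * √P * (√P * (Real.pi / lam)) * δ / v *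
        ((S.card + 1) / 2)) ≤
        N * Real.log (1 + 4 * δ * P * (1 + δ) * (N : ℝ) ^ (3 / 2 : ℝ) / (lam * v)) := by
      refine mul_le_mul hcard' (Real.log_le_log (by positivity) (add_le_add_right ?_ _))
        (Real.log_nonneg (le_add_of_nonneg_right (by positivity))) (by positivity)
      have e1 : 2 * √P * (√P * (Real.pi / lam)) * δ / v * ((S.card + 1) / 2) =
          δ * P * (Real.pi * (S.card + 1)) / (lam * v) := by
        rw [show 2 * √P * (√P * (Real.pi / lam)) = 2 * (√P * √P) * (Real.pi / lam) by ring,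
          Real.mul_self_sqrt hP]
        field_simp
      rw [e1]
      refine div_le_div_of_nonneg_right ?_ (by positivity)
      have h1 := pi_mul_add_one_le_rpow hN2
      have h2 : Real.pi * ((S.card : ℝ) + 1) ≤ Real.pi * (N + 1) := by
        gcongr
      have h3 : 0 ≤ δ * P := by positivity
      have h4 := mul_le_mul_of_nonneg_left (h2.trans h1) h3
      -- The factor `1 + δ` in the stated term is slack.
      have h5 : 0 ≤ δ * P * (N : ℝ) ^ (3 / 2 : ℝ) * δ := by positivity
      nlinarith
    linarith

end GreedyBound

/-! ### Lipschitz and square-summability bounds for the sinc coefficients -/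

section Sinc

lemma sinc_eq_integral (u : ℝ) : Real.sinc u = ∫ t in (0 : ℝ)..1, Real.cos (t * u) := by
  rcases eq_or_ne u 0 with rfl | hu
  · simp
  · rw [intervalIntegral.integral_comp_mul_right (fun t => Real.cos t) hu]
    simp [Real.sinc_of_ne_zero hu, div_eq_inv_mul]

/-- An average of the functions `cos (t u)`, `t ∈ [0, 1]`, each `t`-Lipschitz in `u`; the mean of
`t` is `1 / 2`. -/
lemma abs_sinc_sub_sinc_le (u w : ℝ) : |Real.sinc u - Real.sinc w| ≤ 1 / 2 * |u - w| := by
  rw [sinc_eq_integral, sinc_eq_integral, ← intervalIntegral.integral_sub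
    (Continuous.intervalIntegrable (by fun_prop) _ _)
    (Continuous.intervalIntegrable (by fun_prop) _ _), ← Real.norm_eq_abs]
  have h : ∀ t ∈ Set.Ioc (0 : ℝ) 1, ‖Real.cos (t * u) - Real.cos (t * w)‖ ≤ t * |u - w| := by
    intro t ht
    have := Real.abs_cos_sub_cos_le (t * u) (t * w)
    rw [← mul_sub, abs_mul, abs_of_pos ht.1] at this
    exact this
  refine (intervalIntegral.norm_integral_le_of_norm_le zero_le_one
    (Filter.Eventually.of_forall h)
    (Continuous.intervalIntegrable (by fun_prop) _ _)).trans (le_of_eq ?_)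
  rw [intervalIntegral.integral_mul_const, integral_id]
  norm_num

lemma abs_coeff_le_one (lam x : ℝ) (m : ℤ) : |coeff lam x m| ≤ 1 := Real.abs_sinc_le_one _

lemma abs_coeff_sub_coeff_le {lam : ℝ} (hlam : 0 < lam) (x y : ℝ) (m : ℤ) :
    |coeff lam x m - coeff lam y m| ≤ Real.pi / lam * |x - y| := by
  refine (abs_sinc_sub_sinc_le _ _).trans (le_of_eq ?_)
  have : Real.pi * ((m : ℝ) + 2 / lam * x) - Real.pi * ((m : ℝ) + 2 / lam * y) =
      Real.pi * (2 / lam) * (x - y) := by ring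
  rw [this, abs_mul, abs_of_pos (by positivity)]
  ring

lemma summable_coeff_sq (lam x : ℝ) : Summable fun m : ℤ => coeff lam x m ^ 2 := by
  have h := (Real.summable_one_div_int_add_rpow (2 / lam * x) 2).2 (by norm_num)
  -- If the argument vanishes for some `m`, the majorant `1 / |t| ^ 2` is zero by convention
  -- although the coefficient is `1`. The extra term covers that index.
  have h0 : Summable fun m : ℤ => if m = -⌊2 / lam * x⌋ then (1 : ℝ) else 0 :=
    (hasSum_ite_eq _ _).summable
  refine Summable.of_nonneg_of_le (fun m => sq_nonneg _) (fun m => ?_) (h.add h0)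
  set t : ℝ := (m : ℝ) + 2 / lam * x with ht
  rcases eq_or_ne t 0 with h1 | h1
  · have h2 : m = -⌊2 / lam * x⌋ := by
      have : 2 / lam * x = ((-m : ℤ) : ℝ) := by push_cast; linarith
      rw [this, Int.floor_intCast, neg_neg]
    rw [if_pos h2]
    have h3 := (sq_le_one_iff_abs_le_one _).2 (abs_coeff_le_one lam x m)
    have h4 : 0 ≤ 1 / |t| ^ (2 : ℝ) := by positivity
    linarith
  · have h2 : coeff lam x m ^ 2 ≤ 1 / |t| ^ (2 : ℝ) := by
      have h3 : Real.pi * t ≠ 0 := mul_ne_zero Real.pi_ne_zero h1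
      rw [coeff, ← ht, Real.sinc_of_ne_zero h3, div_pow, Real.rpow_two, sq_abs]
      have h4 := Real.sin_sq_le_one (Real.pi * t)
      have h5 : 0 < t ^ 2 := by positivity
      have h6 : t ^ 2 ≤ (Real.pi * t) ^ 2 := by
        rw [mul_pow]
        exact le_mul_of_one_le_left h5.le (by nlinarith [Real.pi_gt_three])
      exact div_le_div₀ zero_le_one h4 h5 h6
    have h3 : (0 : ℝ) ≤ if m = -⌊2 / lam * x⌋ then 1 else 0 := by split_ifs <;> norm_num
    linarith

end Sinc

/-! ### Scene vectors in `ℓ²` -/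

section SceneVec

lemma summable_mul_sq_of_abs_le {t : ℤ → ℝ≥0} (ht : Summable t) {c : ℤ → ℝ} {b : ℝ}
    (hc : ∀ m, |c m| ≤ b) : Summable fun m => (t m : ℝ) * c m ^ 2 := by
  refine Summable.of_nonneg_of_le (fun m => by positivity) (fun m => ?_)
    ((NNReal.summable_coe.2 ht).mul_right (b ^ 2))
  exact mul_le_mul_of_nonneg_left (sq_le_sq' (neg_le_of_abs_le (hc m)) (le_of_abs_le (hc m)))
    (NNReal.coe_nonneg _)

/-- The coefficients at position `x`, weighted by the standard deviations of the scene, as an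
element of `ℓ²`: inner products are the covariances of the noiseless readings. -/
noncomputable def sceneVec (lam : ℝ) (t : ℤ → ℝ≥0) (ht : Summable t) (x : ℝ) :
    lp (fun _ : ℤ => ℝ) 2 :=
  ⟨fun m => √(t m) * coeff lam x m, by
    refine memℓp_gen ?_
    have := summable_mul_sq_of_abs_le ht (abs_coeff_le_one lam x)
    refine this.congr fun m => ?_
    rw [ENNReal.toReal_ofNat, Real.rpow_two, Real.norm_eq_abs, sq_abs, mul_pow,
      Real.sq_sqrt (NNReal.coe_nonneg _)]⟩

lemma sceneVec_apply (lam : ℝ) (t : ℤ → ℝ≥0) (ht : Summable t) (x : ℝ) (m : ℤ) :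
    sceneVec lam t ht x m = √(t m) * coeff lam x m := rfl

lemma hasSum_inner_sceneVec (lam : ℝ) (t : ℤ → ℝ≥0) (ht : Summable t) (x y : ℝ) :
    HasSum (fun m => (t m : ℝ) * (coeff lam x m * coeff lam y m))
      (inner ℝ (sceneVec lam t ht x) (sceneVec lam t ht y)) := by
  refine (lp.hasSum_inner (𝕜 := ℝ) (sceneVec lam t ht x) (sceneVec lam t ht y)).congr_fun
    fun m => ?_
  rw [sceneVec_apply, sceneVec_apply]
  nth_rewrite 1 [← Real.mul_self_sqrt (NNReal.coe_nonneg (t m))]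
  simp only [RCLike.inner_apply, conj_trivial]
  ring

/-- Serves both for the norm of a scene vector and for the distance between two of them. -/
lemma norm_sq_le_of_abs_le {t : ℤ → ℝ≥0} (ht : Summable t) {c : ℤ → ℝ} {b : ℝ}
    (hc : ∀ m, |c m| ≤ b) (f : lp (fun _ : ℤ => ℝ) 2) (hf : ∀ m, f m = √(t m) * c m) :
    ‖f‖ ^ 2 ≤ (∑' m, (t m : ℝ)) * b ^ 2 := by
  rw [← real_inner_self_eq_norm_sq, lp.inner_eq_tsum, ← tsum_mul_right]
  have h : ∀ m, inner ℝ (f m) (f m) = (t m : ℝ) * c m ^ 2 := by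
    intro m
    rw [hf, real_inner_self_eq_norm_sq, Real.norm_eq_abs, sq_abs, mul_pow,
      Real.sq_sqrt (NNReal.coe_nonneg _)]
  simp_rw [h]
  refine (summable_mul_sq_of_abs_le ht hc).tsum_le_tsum (fun m => ?_)
    ((NNReal.summable_coe.2 ht).mul_right (b ^ 2))
  exact mul_le_mul_of_nonneg_left (sq_le_sq' (neg_le_of_abs_le (hc m)) (le_of_abs_le (hc m)))
    (NNReal.coe_nonneg _)

lemma norm_sceneVec_sq_le (lam : ℝ) (t : ℤ → ℝ≥0) (ht : Summable t) (x : ℝ) :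
    ‖sceneVec lam t ht x‖ ^ 2 ≤ ∑' m, (t m : ℝ) := by
  simpa using norm_sq_le_of_abs_le ht (abs_coeff_le_one lam x) _ (sceneVec_apply lam t ht x)

lemma norm_sceneVec_sub_le {lam : ℝ} (hlam : 0 < lam) (t : ℤ → ℝ≥0) (ht : Summable t) (x y : ℝ) :
    ‖sceneVec lam t ht x - sceneVec lam t ht y‖ ≤
      √(∑' m, (t m : ℝ)) * (Real.pi / lam) * |x - y| := by
  have h := norm_sq_le_of_abs_le ht (abs_coeff_sub_coeff_le hlam x y)
    (sceneVec lam t ht x - sceneVec lam t ht y) (fun m => by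
      rw [lp.coeFn_sub, Pi.sub_apply, sceneVec_apply, sceneVec_apply]; ring)
  refine (Real.le_sqrt_of_sq_le h).trans (le_of_eq ?_)
  rw [Real.sqrt_mul' _ (sq_nonneg _), Real.sqrt_sq (by positivity), mul_assoc]

end SceneVec

/-! ### Characteristic function, moments and density of circular Gaussians -/

section CircularGaussian

lemma measurable_ofReal_add_ofReal_mul_I :
    Measurable fun p : ℝ × ℝ => (p.1 : ℂ) + (p.2 : ℂ) * Complex.I := by fun_prop

instance isProbabilityMeasure_circularGaussian (v : ℝ≥0) :
    IsProbabilityMeasure (circularGaussian v) :=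
  Measure.isProbabilityMeasure_map measurable_ofReal_add_ofReal_mul_I.aemeasurable

lemma norm_ofReal_add_ofReal_mul_I_sq (x y : ℝ) :
    ‖(x : ℂ) + (y : ℂ) * Complex.I‖ ^ 2 = x ^ 2 + y ^ 2 := by
  rw [← Complex.normSq_eq_norm_sq, Complex.normSq_add_mul_I]

lemma charFun_circularGaussian (v : ℝ≥0) (z : ℂ) :
    charFun (circularGaussian v) z = Complex.exp (-(v * ‖z‖ ^ 2 / 4 : ℝ)) := by
  rw [charFun_apply, circularGaussian,
    integral_map measurable_ofReal_add_ofReal_mul_I.aemeasurable (by fun_prop)]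
  have h : ∀ p : ℝ × ℝ,
      Complex.exp (inner ℝ ((p.1 : ℂ) + (p.2 : ℂ) * Complex.I) z * Complex.I) =
      Complex.exp (z.re * p.1 * Complex.I) * Complex.exp (z.im * p.2 * Complex.I) := by
    intro p
    rw [← Complex.exp_add, Complex.inner]
    congr 1
    simp
    ring
  simp_rw [h]
  rw [integral_prod_mul (fun x : ℝ => Complex.exp (z.re * x * Complex.I))
    (fun x : ℝ => Complex.exp (z.im * x * Complex.I)), ← charFun_apply_real, ← charFun_apply_real,
    charFun_gaussianReal, charFun_gaussianReal, ← Complex.exp_add, ← Complex.normSq_eq_norm_sq,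
    Complex.normSq_apply]
  congr 1
  push_cast
  ring

lemma integrable_sq_gaussianReal (v : ℝ≥0) : Integrable (fun x : ℝ => x ^ 2) (gaussianReal 0 v) :=
  (memLp_id_gaussianReal 2).integrable_sq

lemma integral_sq_gaussianReal (v : ℝ≥0) : ∫ x, x ^ 2 ∂(gaussianReal 0 v) = v := by
  have h := variance_id_gaussianReal (μ := 0) (v := v)
  rw [variance_of_integral_eq_zero aemeasurable_id (by simp)] at h
  simpa using h

lemma integrable_norm_sq_circularGaussian (v : ℝ≥0) :
    Integrable (fun z : ℂ => ‖z‖ ^ 2) (circularGaussian v) := by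
  rw [circularGaussian, integrable_map_measure (by fun_prop)
    measurable_ofReal_add_ofReal_mul_I.aemeasurable]
  simp only [Function.comp_def, norm_ofReal_add_ofReal_mul_I_sq]
  exact ((integrable_sq_gaussianReal _).comp_fst _).add ((integrable_sq_gaussianReal _).comp_snd _)

lemma integral_norm_sq_circularGaussian (v : ℝ≥0) :
    ∫ z, ‖z‖ ^ 2 ∂(circularGaussian v) = v := by
  rw [circularGaussian, integral_map measurable_ofReal_add_ofReal_mul_I.aemeasurable (by fun_prop)]
  simp only [norm_ofReal_add_ofReal_mul_I_sq]
  rw [integral_add ((integrable_sq_gaussianReal _).comp_fst _)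
    ((integrable_sq_gaussianReal _).comp_snd _), integral_fun_fst (fun x : ℝ => x ^ 2),
    integral_fun_snd (fun x : ℝ => x ^ 2), integral_sq_gaussianReal]
  simp

/-- The density of the circular complex Gaussian law. -/
noncomputable def circularPDF (v : ℝ≥0) (z : ℂ) : ℝ :=
  (Real.pi * v)⁻¹ * Real.exp (-‖z‖ ^ 2 / v)

lemma circularPDF_pos {v : ℝ≥0} (hv : 0 < v) (z : ℂ) : 0 < circularPDF v z := by
  have : (0 : ℝ) < v := hv
  unfold circularPDF
  have := Real.pi_pos
  positivity

lemma measurable_circularPDF (v : ℝ≥0) : Measurable (circularPDF v) := by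
  unfold circularPDF
  fun_prop

lemma log_circularPDF {v : ℝ≥0} (hv : 0 < v) (z : ℂ) :
    Real.log (circularPDF v z) = -Real.log Real.pi - Real.log v - ‖z‖ ^ 2 / v := by
  have : (0 : ℝ) < v := hv
  rw [circularPDF, Real.log_mul (by positivity) (Real.exp_pos _).ne', Real.log_exp, Real.log_inv,
    Real.log_mul Real.pi_ne_zero this.ne']
  ring

lemma circularPDF_ofReal_add {v : ℝ≥0} (hv : 0 < v) (x y : ℝ) :
    circularPDF v ((x : ℂ) + (y : ℂ) * Complex.I) =
      gaussianPDFReal 0 (v / 2) x * gaussianPDFReal 0 (v / 2) y := by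
  have hv' : (0 : ℝ) < v := hv
  rw [circularPDF, norm_ofReal_add_ofReal_mul_I_sq, gaussianPDFReal, gaussianPDFReal]
  push_cast
  rw [mul_mul_mul_comm, ← Real.exp_add, ← mul_inv, Real.mul_self_sqrt (by positivity)]
  congr 2
  · ring
  · field_simp
    ring

lemma circularGaussian_eq_withDensity {v : ℝ≥0} (hv : 0 < v) :
    circularGaussian v = volume.withDensity fun z => ENNReal.ofReal (circularPDF v z) := by
  have hv2 : v / 2 ≠ 0 := by positivity
  have hmeas : Measurable fun z => ENNReal.ofReal (circularPDF v z) :=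
    (measurable_circularPDF v).ennreal_ofReal
  ext s hs
  rw [circularGaussian, gaussianReal_of_var_ne_zero _ hv2,
    prod_withDensity (measurable_gaussianPDF _ _) (measurable_gaussianPDF _ _),
    Measure.map_apply measurable_ofReal_add_ofReal_mul_I hs,
    withDensity_apply _ (measurable_ofReal_add_ofReal_mul_I hs), withDensity_apply _ hs,
    ← Complex.volume_preserving_equiv_real_prod.symm.setLIntegral_comp_preimage_emb
      Complex.measurableEquivRealProd.symm.measurableEmbedding]
  have hset : (fun p : ℝ × ℝ => (p.1 : ℂ) + (p.2 : ℂ) * Complex.I) ⁻¹' s =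
      Complex.measurableEquivRealProd.symm ⁻¹' s := by
    ext p
    simp [Complex.measurableEquivRealProd_symm_apply, Complex.mk_eq_add_mul_I]
  rw [hset]
  refine lintegral_congr fun p => ?_
  rw [Complex.measurableEquivRealProd_symm_apply, Complex.mk_eq_add_mul_I,
    circularPDF_ofReal_add hv, ENNReal.ofReal_mul (gaussianPDFReal_nonneg _ _ _)]
  rfl

lemma integrable_circularPDF {v : ℝ≥0} (hv : 0 < v) : Integrable (circularPDF v) := by
  refine ⟨(measurable_circularPDF v).aestronglyMeasurable, ?_⟩
  rw [hasFiniteIntegral_iff_ofReal (Filter.Eventually.of_forall fun z => (circularPDF_pos hv z).le)]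
  have h := measure_univ (μ := circularGaussian v)
  rw [circularGaussian_eq_withDensity hv, withDensity_apply _ MeasurableSet.univ,
    Measure.restrict_univ] at h
  rw [h]
  exact ENNReal.one_lt_top

variable {ι : Type*} [Fintype ι]

/-- A product of measures with densities has the product of the densities as density. -/
lemma pi_withDensity_ofReal {f : ι → ℂ → ℝ} (hf : ∀ i, Integrable (f i)) (hf0 : ∀ i z, 0 ≤ f i z) :
    Measure.pi (fun i => (volume : Measure ℂ).withDensity fun z => ENNReal.ofReal (f i z)) =
      (volume : Measure (ι → ℂ)).withDensity fun z => ENNReal.ofReal (∏ i, f i (z i)) := by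
  have hsf : ∀ i, SigmaFinite ((volume : Measure ℂ).withDensity fun z => ENNReal.ofReal (f i z)) :=
    fun i => SigmaFinite.withDensity_ofReal _
  refine Measure.pi_eq fun s hs => ?_
  rw [withDensity_apply _ (MeasurableSet.univ_pi hs)]
  have hint : Integrable (fun z : ι → ℂ => ∏ i, f i (z i)) := Integrable.fintype_prod hf
  rw [← ofReal_integral_eq_lintegral_ofReal hint.integrableOn
    (Filter.Eventually.of_forall fun z => Finset.prod_nonneg fun i _ => hf0 i _)]
  have hprod : ∫ z in Set.univ.pi s, ∏ i, f i (z i) = ∏ i, ∫ z in s i, f i z := by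
    rw [← integral_indicator (MeasurableSet.univ_pi hs)]
    simp_rw [← integral_indicator (hs _)]
    rw [← integral_fintype_prod_volume_eq_prod]
    congr 1
    ext z
    by_cases hz : z ∈ Set.univ.pi s
    · rw [Set.indicator_of_mem hz]
      refine Finset.prod_congr rfl fun i _ => ?_
      rw [Set.indicator_of_mem (hz i (Set.mem_univ i))]
    · rw [Set.indicator_of_notMem hz]
      simp only [Set.mem_pi, Set.mem_univ, forall_const, not_forall] at hz
      obtain ⟨i, hi⟩ := hz
      exact (Finset.prod_eq_zero (Finset.mem_univ i) (Set.indicator_of_notMem hi _)).symm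
  rw [hprod, ENNReal.ofReal_prod_of_nonneg fun i _ => integral_nonneg fun z => hf0 i z]
  refine Finset.prod_congr rfl fun i _ => ?_
  rw [withDensity_apply _ (hs i), ofReal_integral_eq_lintegral_ofReal (hf i).integrableOn
    (Filter.Eventually.of_forall fun z => hf0 i z)]

lemma pi_circularGaussian_eq_withDensity {d : ι → ℝ≥0} (hd : ∀ i, 0 < d i) :
    Measure.pi (fun i => circularGaussian (d i)) =
      volume.withDensity fun z : ι → ℂ => ENNReal.ofReal (∏ i, circularPDF (d i) (z i)) := by
  rw [← pi_withDensity_ofReal (fun i => integrable_circularPDF (hd i))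
    fun i z => (circularPDF_pos (hd i) z).le]
  congr 1
  ext1 i
  exact circularGaussian_eq_withDensity (hd i)

end CircularGaussian

/-! ### Series of independent circular Gaussians -/

section GaussianSeries

variable {Ω : Type*} [MeasurableSpace Ω] {μ : Measure Ω}
variable {J : Type*} {β : J → Ω → ℂ} {t : J → ℝ≥0}

/-- By Tonelli, the expectation of the sum is `∑ t j`, which is finite. -/
lemma ae_summable_norm_sq [Countable J]
    (hβ : ∀ j, HasLaw (β j) (circularGaussian (t j)) μ) (ht : Summable t) :
    ∀ᵐ ω ∂μ, Summable fun j => ‖β j ω‖ ^ 2 := by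
  have hmeas : ∀ j, AEMeasurable (fun ω => ENNReal.ofReal (‖β j ω‖ ^ 2)) μ := fun j =>
    (((hβ j).aemeasurable.norm).pow_const 2).ennreal_ofReal
  have hint : ∀ j, ∫⁻ ω, ENNReal.ofReal (‖β j ω‖ ^ 2) ∂μ = t j := by
    intro j
    have h := (hβ j).lintegral_comp (f := fun z : ℂ => ENNReal.ofReal (‖z‖ ^ 2)) (by fun_prop)
    refine Eq.trans h ?_
    rw [← ofReal_integral_eq_lintegral_ofReal (integrable_norm_sq_circularGaussian _)
      (Filter.Eventually.of_forall fun z => sq_nonneg _), integral_norm_sq_circularGaussian,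
      ENNReal.ofReal_coe_nnreal]
  have hfin : ∫⁻ ω, ∑' j, ENNReal.ofReal (‖β j ω‖ ^ 2) ∂μ ≠ ∞ := by
    rw [lintegral_tsum hmeas]
    simp_rw [hint]
    exact ENNReal.tsum_coe_ne_top_iff_summable.2 ht
  filter_upwards [ae_lt_top' (AEMeasurable.tsum hmeas) hfin] with ω hω
  have := ENNReal.summable_toReal hω.ne
  simpa [ENNReal.toReal_ofReal] using this

/-- A single null set serves all square-summable `c`, since `|c j| ‖β j‖ ≤ c j ^ 2 + ‖β j‖ ^ 2`. -/
lemma ae_forall_summable_mul [Countable J]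
    (hβ : ∀ j, HasLaw (β j) (circularGaussian (t j)) μ) (ht : Summable t) :
    ∀ᵐ ω ∂μ, ∀ c : J → ℝ, (Summable fun j => c j ^ 2) → Summable fun j => (c j : ℂ) * β j ω := by
  filter_upwards [ae_summable_norm_sq hβ ht] with ω hω c hc
  refine Summable.of_norm_bounded (hc.add hω) fun j => ?_
  rw [norm_mul, Complex.norm_real, Real.norm_eq_abs]
  nlinarith [sq_nonneg (|c j| - ‖β j ω‖), sq_abs (c j), sq_nonneg (c j), sq_nonneg ‖β j ω‖]

lemma integral_exp_sum_inner [IsProbabilityMeasure μ] (hβ : ∀ j, HasLaw (β j) (circularGaussian (t j)) μ)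
    (hind : iIndepFun β μ) (η : J → ℂ) (F : Finset J) :
    ∫ ω, Complex.exp ((∑ j ∈ F, inner ℝ (β j ω) (η j) : ℝ) * Complex.I) ∂μ =
      Complex.exp (-(∑ j ∈ F, t j * ‖η j‖ ^ 2 / 4 : ℝ)) := by
  have hF : iIndepFun (fun j : F => β j) μ := hind.precomp Subtype.val_injective
  have h := hF.integral_fun_prod_comp (f := fun (j : F) (z : ℂ) =>
    Complex.exp (inner ℝ z (η j) * Complex.I)) (fun j => (hβ j).aemeasurable)
    (fun j => by fun_prop)
  have h1 : ∀ j, ∫ ω, Complex.exp (inner ℝ (β j ω) (η j) * Complex.I) ∂μ =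
      Complex.exp (-(t j * ‖η j‖ ^ 2 / 4 : ℝ)) := by
    intro j
    rw [← charFun_circularGaussian, ← (hβ j).map_eq, charFun_apply,
      integral_map (hβ j).aemeasurable (by fun_prop)]
  simp_rw [h1] at h
  rw [Finset.prod_coe_sort F fun j => Complex.exp (-(t j * ‖η j‖ ^ 2 / 4 : ℝ)),
    ← Complex.exp_sum] at h
  push_cast at h ⊢
  rw [← Finset.sum_neg_distrib]
  refine Eq.trans (integral_congr_ae (Filter.Eventually.of_forall fun ω => ?_)) h
  simp only
  rw [← Complex.exp_sum, Finset.sum_mul,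
    Finset.sum_coe_sort F fun j => (inner ℝ (β j ω) (η j) : ℂ) * Complex.I]

variable {ι : Type*} [Fintype ι]

lemma aemeasurable_tsum_mul [Countable J] (hβ : ∀ j, HasLaw (β j) (circularGaussian (t j)) μ)
    (ht : Summable t) {b : J → ℝ} (hb : Summable fun j => b j ^ 2) :
    AEMeasurable (fun ω => ∑' j, (b j : ℂ) * β j ω) μ := by
  refine aemeasurable_of_tendsto_metrizable_ae (u := Filter.atTop)
    (f := fun (F : Finset J) ω => ∑ j ∈ F, (b j : ℂ) * β j ω) (fun F => ?_) ?_
  · exact Finset.aemeasurable_fun_sum F fun j _ => (hβ j).aemeasurable.const_mul _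
  · filter_upwards [ae_forall_summable_mul hβ ht] with ω hω
    exact (hω _ hb).hasSum

/-- Orthogonal linear combinations of independent circular Gaussian variables are independent
circular Gaussian variables. -/
theorem hasLaw_tsum_mul [DecidableEq ι] [IsProbabilityMeasure μ] [Countable J] (hβ : ∀ j, HasLaw (β j) (circularGaussian (t j)) μ)
    (hind : iIndepFun β μ) (ht : Summable t) {b : ι → J → ℝ}
    (hb : ∀ i, Summable fun j => b i j ^ 2) {d : ι → ℝ≥0}
    (hbd : ∀ i k, HasSum (fun j => (t j : ℝ) * (b i j * b k j)) (if i = k then (d i : ℝ) else 0)) :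
    HasLaw (fun ω i => ∑' j, (b i j : ℂ) * β j ω) (Measure.pi fun i => circularGaussian (d i)) μ := by
  have hmeas : AEMeasurable (fun ω i => ∑' j, (b i j : ℂ) * β j ω) μ :=
    aemeasurable_pi_iff.2 fun i => aemeasurable_tsum_mul hβ ht (hb i)
  refine ⟨hmeas, ?_⟩
  have := Measure.isProbabilityMeasure_map hmeas
  refine charFun_eq_pi_iff.1 fun ξ => ?_
  rw [charFun_apply, AEMeasurable.map_map_of_aemeasurable (by fun_prop) hmeas,
    integral_map (by fun_prop) (by fun_prop)]
  simp only [Function.comp_apply, PiLp.inner_apply, charFun_circularGaussian]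
  rw [← Complex.exp_sum]
  -- Pairing the vector of series with `ξ` gives a single series in the `β j`. The characteristic
  -- functions of its partial sums are computed in two ways: by dominated convergence, and
  -- explicitly by independence.
  set η : J → ℂ := fun j => ∑ i, (b i j : ℂ) * ξ i with hη
  have hinner : ∀ (z w : ℂ) (c : ℝ), inner ℝ ((c : ℂ) * z) w = inner ℝ z ((c : ℂ) * w) := by
    intro z w c
    rw [← Complex.real_smul, ← Complex.real_smul, real_inner_smul_left, real_inner_smul_right]
  have hlim1 : Filter.Tendsto
      (fun F : Finset J => ∫ ω, Complex.exp ((∑ j ∈ F, inner ℝ (β j ω) (η j) : ℝ) * Complex.I) ∂μ)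
      Filter.atTop (nhds (∫ ω, Complex.exp ((∑ i, inner ℝ (∑' j, (b i j : ℂ) * β j ω) (ξ i) : ℝ) *
        Complex.I) ∂μ)) := by
    refine tendsto_integral_filter_of_dominated_convergence (fun _ => 1) ?_ ?_
      (integrable_const _) ?_
    · refine Filter.Eventually.of_forall fun F => AEMeasurable.aestronglyMeasurable ?_
      refine Complex.measurable_exp.comp_aemeasurable (AEMeasurable.mul_const ?_ _)
      refine Complex.measurable_ofReal.comp_aemeasurable ?_
      exact Finset.aemeasurable_fun_sum F fun j _ =>
        (hβ j).aemeasurable.inner aemeasurable_const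
    · exact Filter.Eventually.of_forall fun F => Filter.Eventually.of_forall fun ω =>
        (Complex.norm_exp_ofReal_mul_I _).le
    · filter_upwards [ae_forall_summable_mul hβ ht] with ω hω
      have hsum : HasSum (fun j => inner ℝ (β j ω) (η j))
          (∑ i, inner ℝ (∑' j, (b i j : ℂ) * β j ω) (ξ i)) := by
        have h1 : ∀ j, inner ℝ (β j ω) (η j) = ∑ i, inner ℝ ((b i j : ℂ) * β j ω) (ξ i) := by
          intro j
          rw [hη, inner_sum]
          exact Finset.sum_congr rfl fun i _ => (hinner _ _ _).symm
        simp_rw [h1]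
        refine hasSum_sum fun i _ => ?_
        have h2 := (hω _ (hb i)).hasSum.mapL (innerSL ℝ (ξ i))
        simpa [real_inner_comm] using h2
      exact ((Complex.continuous_exp.comp (Complex.continuous_ofReal.mul continuous_const)).tendsto
        _).comp hsum
  have hlim2 : Filter.Tendsto
      (fun F : Finset J => ∫ ω, Complex.exp ((∑ j ∈ F, inner ℝ (β j ω) (η j) : ℝ) * Complex.I) ∂μ)
      Filter.atTop (nhds (Complex.exp (-(∑ i, d i * ‖ξ i‖ ^ 2 / 4 : ℝ)))) := by
    simp_rw [integral_exp_sum_inner hβ hind η]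
    -- Expanding `‖η j‖ ^ 2` as a double sum, orthogonality of the rows of `b` leaves only the
    -- diagonal.
    have hsum : HasSum (fun j => (t j : ℝ) * ‖η j‖ ^ 2 / 4) (∑ i, d i * ‖ξ i‖ ^ 2 / 4) := by
      rw [← Finset.sum_div]
      refine HasSum.div_const ?_ 4
      have h1 : ∀ j, (t j : ℝ) * ‖η j‖ ^ 2 =
          ∑ i, ∑ k, (t j : ℝ) * (b i j * b k j) * inner ℝ (ξ i) (ξ k) := by
        intro j
        rw [← real_inner_self_eq_norm_sq, hη, sum_inner, Finset.mul_sum]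
        refine Finset.sum_congr rfl fun i _ => ?_
        rw [inner_sum, Finset.mul_sum]
        refine Finset.sum_congr rfl fun k _ => ?_
        rw [← Complex.real_smul, ← Complex.real_smul, real_inner_smul_left, real_inner_smul_right]
        ring
      have h2 : ∑ i, (d i : ℝ) * ‖ξ i‖ ^ 2 =
          ∑ i, ∑ k, (if i = k then (d i : ℝ) else 0) * inner ℝ (ξ i) (ξ k) := by
        refine Finset.sum_congr rfl fun i _ => ?_
        simp [-Complex.inner]
      simp_rw [h1]
      rw [h2]
      exact hasSum_sum fun i _ => hasSum_sum fun k _ => (hbd i k).mul_right _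
    exact ((Complex.continuous_exp.comp Complex.continuous_ofReal.neg).tendsto _).comp hsum
  rw [tendsto_nhds_unique hlim1 hlim2]
  push_cast
  rw [Finset.sum_neg_distrib]

/-- Sums of independent circular Gaussian vectors. -/
lemma hasLaw_add_pi_circularGaussian [IsProbabilityMeasure μ] {Z W : Ω → ι → ℂ} {d e : ι → ℝ≥0}
    (hZ : HasLaw Z (Measure.pi fun i => circularGaussian (d i)) μ)
    (hW : HasLaw W (Measure.pi fun i => circularGaussian (e i)) μ) (hZW : IndepFun Z W μ) :
    HasLaw (Z + W) (Measure.pi fun i => circularGaussian (d i + e i)) μ := by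
  have hmeas : AEMeasurable (Z + W) μ := hZ.aemeasurable.add hW.aemeasurable
  refine ⟨hmeas, ?_⟩
  have := Measure.isProbabilityMeasure_map hmeas
  refine charFun_eq_pi_iff.1 fun ξ => ?_
  have hind : IndepFun (fun ω => WithLp.toLp 2 (Z ω)) (fun ω => WithLp.toLp 2 (W ω)) μ :=
    hZW.comp (φ := WithLp.toLp 2) (ψ := WithLp.toLp 2) (by fun_prop) (by fun_prop)
  have h := congr_fun (hind.charFun_map_fun_add_eq_mul
    (by have := hZ.aemeasurable; fun_prop) (by have := hW.aemeasurable; fun_prop)) ξ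
  have hZ' := charFun_eq_pi_iff.2 hZ.map_eq ξ
  have hW' := charFun_eq_pi_iff.2 hW.map_eq ξ
  rw [AEMeasurable.map_map_of_aemeasurable (by fun_prop) hZ.aemeasurable] at hZ'
  rw [AEMeasurable.map_map_of_aemeasurable (by fun_prop) hW.aemeasurable] at hW'
  rw [AEMeasurable.map_map_of_aemeasurable (by fun_prop) hmeas]
  simp only [Function.comp_def] at hZ' hW' ⊢
  rw [Pi.mul_apply, hZ', hW', ← Finset.prod_mul_distrib] at h
  refine h.trans (Finset.prod_congr rfl fun i _ => ?_)
  rw [charFun_circularGaussian, charFun_circularGaussian, charFun_circularGaussian,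
    ← Complex.exp_add]
  congr 1
  push_cast
  ring

end GaussianSeries

/-! ### Mutual information of an additive Gaussian channel -/

section MutualInfo

variable {Ω : Type*} [MeasurableSpace Ω] {μ : Measure Ω}
variable {α α' γ : Type*} [MeasurableSpace α] [MeasurableSpace α'] [MeasurableSpace γ]

lemma mutualInfo_congr {X X' : Ω → α} (h : X =ᵐ[μ] X') (Y : Ω → γ) :
    mutualInfo X Y μ = mutualInfo X' Y μ := by
  unfold mutualInfo
  have h' : (fun ω => (X ω, Y ω)) =ᵐ[μ] fun ω => (X' ω, Y ω) := h.mono fun ω hω => by simp only [hω]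
  rw [Measure.map_congr h, Measure.map_congr h']

/-- Processing an observation does not increase its information. -/
lemma mutualInfo_comp_le [IsProbabilityMeasure μ] {X : Ω → α} {Y : Ω → γ} (hX : AEMeasurable X μ) (hY : AEMeasurable Y μ)
    {g : α → α'} (hg : Measurable g) :
    mutualInfo (fun ω => g (X ω)) Y μ ≤ mutualInfo X Y μ := by
  have := Measure.isProbabilityMeasure_map hX
  have := Measure.isProbabilityMeasure_map hY
  have := Measure.isProbabilityMeasure_map (hX.prodMk hY)
  have h := InformationTheory.klDiv_map_le (μ := μ.map fun ω => (X ω, Y ω))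
    (ν := (μ.map X).prod (μ.map Y)) (g := Prod.map g id) (hg.prodMap measurable_id)
  rw [AEMeasurable.map_map_of_aemeasurable (by fun_prop) (hX.prodMk hY),
    ← Measure.map_prod_map _ _ hg measurable_id, Measure.map_id,
    AEMeasurable.map_map_of_aemeasurable hg.aemeasurable hX] at h
  exact h

variable {ι : Type*} [Fintype ι]

lemma lintegral_pi_circularGaussian {d : ι → ℝ≥0} (hd : ∀ i, 0 < d i) {φ : (ι → ℂ) → ℝ≥0∞}
    (hφ : Measurable φ) :
    ∫⁻ z, φ z ∂(Measure.pi fun i => circularGaussian (d i)) =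
      ∫⁻ z, ENNReal.ofReal (∏ i, circularPDF (d i) (z i)) * φ z := by
  have hm : Measurable fun z : ι → ℂ => ENNReal.ofReal (∏ i, circularPDF (d i) (z i)) :=
    (Finset.measurable_fun_prod _ fun i _ =>
      (measurable_circularPDF (d i)).comp (measurable_pi_apply i)).ennreal_ofReal
  rw [pi_circularGaussian_eq_withDensity hd, lintegral_withDensity_eq_lintegral_mul _ hm hφ]
  rfl

/-- The density of the joint law of the input and the output of an additive Gaussian channel with
respect to the product of the marginals. -/
lemma map_gaussianChannel_eq_withDensity (κ : Measure γ) [IsProbabilityMeasure κ]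
    {h : γ → ι → ℂ} (hh : Measurable h) {d e : ι → ℝ≥0} (hd : ∀ i, 0 < d i) (he : ∀ i, 0 < e i) :
    (κ.prod (Measure.pi fun i => circularGaussian (e i))).map
        (fun p : γ × (ι → ℂ) => (h p.1 + p.2, p.1)) =
      ((Measure.pi fun i => circularGaussian (d i)).prod κ).withDensity fun p =>
        ENNReal.ofReal ((∏ i, circularPDF (e i) (p.1 i - h p.2 i)) /
          ∏ i, circularPDF (d i) (p.1 i)) := by
  have hpdf : ∀ c : ι → ℝ≥0, Measurable fun z : ι → ℂ => ∏ i, circularPDF (c i) (z i) := fun c =>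
    Finset.measurable_fun_prod _ fun i _ =>
      (measurable_circularPDF (c i)).comp (measurable_pi_apply i)
  have hshift : Measurable fun p : γ × (ι → ℂ) => (h p.1 + p.2, p.1) := by fun_prop
  have hsub : Measurable fun p : (ι → ℂ) × γ => p.1 - h p.2 := by fun_prop
  have hf : Measurable fun p : (ι → ℂ) × γ =>
      ENNReal.ofReal ((∏ i, circularPDF (e i) (p.1 i - h p.2 i)) /
          ∏ i, circularPDF (d i) (p.1 i)) :=
    (((hpdf e).comp hsub).div ((hpdf d).comp measurable_fst)).ennreal_ofReal
  refine Measure.ext_of_lintegral _ fun φ hφ => ?_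
  have hφs : Measurable fun p : γ × (ι → ℂ) => φ (h p.1 + p.2, p.1) := hφ.comp hshift
  rw [lintegral_map hφ hshift, lintegral_prod _ hφs.aemeasurable,
    lintegral_withDensity_eq_lintegral_mul _ hf hφ, lintegral_prod_symm' _ (hf.mul hφ)]
  refine lintegral_congr fun y => ?_
  have hm1 : Measurable fun z : ι → ℂ => φ (h y + z, y) := by fun_prop
  refine Eq.trans ?_ (lintegral_pi_circularGaussian hd
    ((hf.mul hφ).comp (measurable_id.prodMk (measurable_const (a := y))))).symm
  -- For a fixed input, the output is the noise translated by `h y`, and volume is translation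
  -- invariant.
  rw [lintegral_pi_circularGaussian he hm1, ← lintegral_sub_right_eq_self _ (h y)]
  refine lintegral_congr fun x => ?_
  have hpos : 0 < ∏ i, circularPDF (d i) (x i) :=
    Finset.prod_pos fun i _ => circularPDF_pos (hd i) _
  simp only [Function.comp_apply, Pi.mul_apply, id_eq]
  rw [← mul_assoc, ← ENNReal.ofReal_mul hpos.le, mul_div_cancel₀ _ hpos.ne']
  simp

/-- The mutual information of the input and the output of an additive Gaussian channel. -/
theorem mutualInfo_gaussianChannel [IsProbabilityMeasure μ] {Y : Ω → γ} (hY : AEMeasurable Y μ) {h : γ → ι → ℂ}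
    (hh : Measurable h) {d : ι → ℝ≥0} {v : ℝ≥0} (hv : 0 < v) {X W : Ω → ι → ℂ}
    (hW : HasLaw W (Measure.pi fun _ => circularGaussian v) μ)
    (hX : HasLaw X (Measure.pi fun i => circularGaussian (d i + v)) μ)
    (hXYW : X =ᵐ[μ] fun ω => h (Y ω) + W ω) (hind : IndepFun Y W μ) :
    mutualInfo X Y μ = ENNReal.ofReal (∑ i, Real.log ((d i + v) / v)) := by
  have hdv : ∀ i, 0 < d i + v := fun i => by positivity
  have hdv' : ∀ i, (0 : ℝ) < d i + v := hdv
  have hv' : (0 : ℝ) < v := hv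
  have := Measure.isProbabilityMeasure_map hY
  have hXY := hX.aemeasurable.prodMk hY
  have := Measure.isProbabilityMeasure_map hXY
  set ν := (Measure.pi fun i => circularGaussian (d i + v)).prod (μ.map Y) with hν
  set f : (ι → ℂ) × γ → ℝ≥0∞ := fun p =>
    ENNReal.ofReal ((∏ i, circularPDF v (p.1 i - h p.2 i)) / ∏ i, circularPDF (d i + v) (p.1 i))
    with hf
  have hfm : Measurable f := by
    have hpdf : ∀ c : ι → ℝ≥0, Measurable fun z : ι → ℂ => ∏ i, circularPDF (c i) (z i) := fun c =>
      Finset.measurable_fun_prod _ fun i _ =>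
        (measurable_circularPDF (c i)).comp (measurable_pi_apply i)
    have hsub : Measurable fun p : (ι → ℂ) × γ => p.1 - h p.2 := by fun_prop
    exact (((hpdf fun _ => v).comp hsub).div ((hpdf _).comp measurable_fst)).ennreal_ofReal
  have hjoint : μ.map (fun ω => (X ω, Y ω)) = ν.withDensity f := by
    rw [hν, hf, ← map_gaussianChannel_eq_withDensity (μ.map Y) hh hdv fun _ => hv, ← hW.map_eq,
      ← (indepFun_iff_map_prod_eq_prod_map_map hY hW.aemeasurable).1 hind,
      AEMeasurable.map_map_of_aemeasurable (by fun_prop) (hY.prodMk hW.aemeasurable)]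
    exact Measure.map_congr (hXYW.mono fun ω hω => by simp [hω])
  have hac : μ.map (fun ω => (X ω, Y ω)) ≪ ν := hjoint ▸ withDensity_absolutelyContinuous _ _
  -- The logarithm of the density. Under the joint law `p.1 - h p.2` is the noise, so both quadratic
  -- terms have mean `1` and cancel, leaving the constants.
  set ψ : (ι → ℂ) × γ → ℝ := fun p =>
    ∑ i, (Real.log ((d i + v) / v) + (‖p.1 i‖ ^ 2 / (d i + v) - ‖p.1 i - h p.2 i‖ ^ 2 / v)) with hψ
  have hψm : Measurable ψ := by
    refine Finset.measurable_fun_sum _ fun i _ => ?_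
    have : Measurable fun p : (ι → ℂ) × γ => h p.2 i :=
      (measurable_pi_apply i).comp (hh.comp measurable_snd)
    fun_prop
  have hllr : llr (μ.map fun ω => (X ω, Y ω)) ν =ᵐ[μ.map fun ω => (X ω, Y ω)] ψ := by
    refine hac.ae_le ?_
    filter_upwards [hjoint ▸ Measure.rnDeriv_withDensity ν hfm] with p hp
    have h1 : 0 < ∏ i, circularPDF v (p.1 i - h p.2 i) :=
      Finset.prod_pos fun i _ => circularPDF_pos hv _
    have h2 : 0 < ∏ i, circularPDF (d i + v) (p.1 i) :=
      Finset.prod_pos fun i _ => circularPDF_pos (hdv i) _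
    rw [llr, hp, hf, ENNReal.toReal_ofReal (by positivity), Real.log_div h1.ne' h2.ne',
      Real.log_prod fun i _ => (circularPDF_pos hv _).ne',
      Real.log_prod fun i _ => (circularPDF_pos (hdv i) _).ne', ← Finset.sum_sub_distrib, hψ]
    refine Finset.sum_congr rfl fun i _ => ?_
    rw [log_circularPDF hv, log_circularPDF (hdv i), Real.log_div (hdv' i).ne' hv'.ne',
      NNReal.coe_add]
    ring
  have hXi : ∀ i, HasLaw (fun ω => X ω i) (circularGaussian (d i + v)) μ := fun i =>
    (measurePreserving_eval _ i).fun_comp_hasLaw hX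
  have hWi : ∀ i, HasLaw (fun ω => W ω i) (circularGaussian v) μ := fun i =>
    (measurePreserving_eval (fun _ => circularGaussian v) i).fun_comp_hasLaw hW
  have hsq : ∀ {U : Ω → ℂ} {c : ℝ≥0}, HasLaw U (circularGaussian c) μ →
      Integrable (fun ω => ‖U ω‖ ^ 2) μ ∧ ∫ ω, ‖U ω‖ ^ 2 ∂μ = c := by
    intro U c hU
    constructor
    · have := integrable_norm_sq_circularGaussian c
      rw [← hU.map_eq] at this
      exact this.comp_aemeasurable hU.aemeasurable
    · rw [← integral_norm_sq_circularGaussian c]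
      exact hU.integral_comp (f := fun z : ℂ => ‖z‖ ^ 2) (by fun_prop)
  have hψXY : (fun ω => ψ (X ω, Y ω)) =ᵐ[μ] fun ω => ∑ i, (Real.log ((d i + v) / v) +
      (‖X ω i‖ ^ 2 / (d i + v) - ‖W ω i‖ ^ 2 / v)) := by
    filter_upwards [hXYW] with ω hω
    refine Finset.sum_congr rfl fun i _ => ?_
    simp [hω]
  have hint_i : ∀ i, Integrable (fun ω => Real.log ((d i + v) / v) +
      (‖X ω i‖ ^ 2 / (d i + v) - ‖W ω i‖ ^ 2 / v)) μ := fun i =>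
    (integrable_const _).add (((hsq (hXi i)).1.div_const _).sub ((hsq (hWi i)).1.div_const _))
  have hintψ : Integrable ψ (μ.map fun ω => (X ω, Y ω)) := by
    rw [integrable_map_measure hψm.aestronglyMeasurable hXY]
    exact (integrable_finsetSum _ fun i _ => hint_i i).congr hψXY.symm
  rw [mutualInfo, hX.map_eq, ← hν,
    InformationTheory.klDiv_of_ac_of_integrable hac (hintψ.congr hllr.symm), integral_congr_ae hllr,
    integral_map hXY hψm.aestronglyMeasurable, integral_congr_ae hψXY,
    integral_finsetSum _ fun i _ => hint_i i]
  congr 1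
  simp only [probReal_univ, add_sub_cancel_right]
  refine Finset.sum_congr rfl fun i _ => ?_
  have h1 := (hsq (hXi i)).1.div_const ((d i : ℝ) + v)
  have h2 := (hsq (hWi i)).1.div_const (v : ℝ)
  have h3 : Integrable (fun ω => ‖X ω i‖ ^ 2 / ((d i : ℝ) + v) - ‖W ω i‖ ^ 2 / (v : ℝ)) μ :=
    h1.sub h2
  rw [integral_add (integrable_const _) h3, integral_sub h1 h2, integral_div, integral_div, (hsq (hXi i)).2, (hsq (hWi i)).2,
      NNReal.coe_add, div_self (hdv' i).ne', div_self hv'.ne']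
  simp

end MutualInfo

/-! ### Diagonalization of the Gram matrix -/

section Spectral

lemma exists_orthogonal_diagonal {ι : Type*} [Fintype ι] [DecidableEq ι] {A : Matrix ι ι ℝ}
    (hA : A.PosSemidef) :
    ∃ (U : Matrix ι ι ℝ) (d : ι → ℝ≥0), U.transpose * U = 1 ∧ U * U.transpose = 1 ∧
      U.transpose * A * U = Matrix.diagonal fun i => (d i : ℝ) := by
  have hH := hA.isHermitian
  set U : Matrix ι ι ℝ := hH.eigenvectorUnitary.1 with hU
  have hstar : star U = U.transpose := by
    rw [Matrix.star_eq_conjTranspose, Matrix.conjTranspose_eq_transpose_of_trivial]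
  refine ⟨U, fun i => ⟨hH.eigenvalues i, hA.eigenvalues_nonneg i⟩, ?_, ?_, ?_⟩
  · rw [← hstar]
    exact Unitary.coe_star_mul_self hH.eigenvectorUnitary
  · rw [← hstar]
    exact Unitary.coe_mul_star_self hH.eigenvectorUnitary
  · have h := hH.conjStarAlgAut_star_eigenvectorUnitary
    rw [Unitary.conjStarAlgAut_star_apply, ← hU, hstar] at h
    rw [h]
    rfl

lemma log_det_noisyGram_eq_sum {H : Type*} [NormedAddCommGroup H] [InnerProductSpace ℝ H]
    {ι : Type*} [Fintype ι] [DecidableEq ι] {v : ℝ≥0} (hv : 0 < v) (x : ι → H)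
    {U : Matrix ι ι ℝ} {d : ι → ℝ≥0} (hU : U.transpose * U = 1)
    (hd : U.transpose * Matrix.gram ℝ x * U = Matrix.diagonal fun i => (d i : ℝ)) :
    Real.log (noisyGram v x).det - Fintype.card ι * Real.log v =
      ∑ i, Real.log ((d i + v) / v) := by
  have hv' : (0 : ℝ) < v := hv
  have hdv : ∀ i, (0 : ℝ) < d i + v := fun i => by positivity
  have h1 : U.transpose * noisyGram v x * U = Matrix.diagonal fun i => (d i + v : ℝ) := by
    rw [noisyGram, Matrix.mul_add, Matrix.add_mul, hd, Matrix.mul_smul, Matrix.mul_one,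
      Matrix.smul_mul, hU, ← Matrix.diagonal_one, ← Matrix.diagonal_smul, Matrix.diagonal_add]
    simp
  have h2 : (noisyGram v x).det = ∏ i, (d i + v : ℝ) := by
    rw [← Matrix.det_diagonal, ← h1, Matrix.det_mul, Matrix.det_mul, mul_right_comm,
      ← Matrix.det_mul, hU, Matrix.det_one, one_mul]
  rw [h2, Real.log_prod fun i _ => (hdv i).ne']
  simp_rw [fun i => Real.log_div (hdv i).ne' hv'.ne']
  rw [Finset.sum_sub_distrib]
  simp

end Spectral

/-! ### Mutual information of linear Gaussian readings -/

section LinearGaussianModel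

variable {Ω : Type*} [MeasurableSpace Ω] {μ : Measure Ω} [IsProbabilityMeasure μ]

/-- The mutual information of countably many independent circular Gaussian variables and finitely
many linear readings of them with independent circular Gaussian noise. -/
theorem mutualInfo_linear_gaussian {J : Type*} [Countable J] {β : J → Ω → ℂ} {t : J → ℝ≥0}
    (hβ : ∀ j, HasLaw (β j) (circularGaussian (t j)) μ) (hβind : iIndepFun β μ) (ht : Summable t)
    {ι : Type*} [Fintype ι] [DecidableEq ι] {W : ι → Ω → ℂ} {v : ℝ≥0} (hv : 0 < v)
    (hW : ∀ i, HasLaw (W i) (circularGaussian v) μ) (hWind : iIndepFun W μ)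
    (hβW : IndepFun (fun ω j => β j ω) (fun ω i => W i ω) μ)
    {a : ι → J → ℝ} (ha : ∀ i, Summable fun j => a i j ^ 2)
    {H : Type*} [NormedAddCommGroup H] [InnerProductSpace ℝ H] {x : ι → H}
    (hx : ∀ i k, HasSum (fun j => (t j : ℝ) * (a i j * a k j)) (inner ℝ (x i) (x k))) :
    mutualInfo (fun ω i => (∑' j, (a i j : ℂ) * β j ω) + W i ω) (fun ω j => β j ω) μ =
      ENNReal.ofReal (Real.log (noisyGram v x).det - Fintype.card ι * Real.log v) := by
  obtain ⟨U, d, hUU, hUU', hUd⟩ := exists_orthogonal_diagonal (Matrix.posSemidef_gram ℝ x)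
  set X : Ω → ι → ℂ := fun ω i => (∑' j, (a i j : ℂ) * β j ω) + W i ω with hX
  set Y : Ω → J → ℂ := fun ω j => β j ω with hYdef
  have hY : AEMeasurable Y μ := aemeasurable_pi_iff.2 fun j => (hβ j).aemeasurable
  have hXm : AEMeasurable X μ := aemeasurable_pi_iff.2 fun i =>
    (aemeasurable_tsum_mul hβ ht (ha i)).add (hW i).aemeasurable
  -- Coefficients of the readings rotated by the transpose of `U`. The rotation decorrelates the
  -- signals, and the noise stays independent with variance `v`.
  set b : ι → J → ℝ := fun i j => ∑ k, U k i * a k j with hb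
  have hbsq : ∀ i, Summable fun j => b i j ^ 2 := by
    intro i
    refine Summable.of_nonneg_of_le (fun j => sq_nonneg _)
      (fun j => sq_sum_le_card_mul_sum_sq (s := Finset.univ) (f := fun k => U k i * a k j)) ?_
    refine Summable.mul_left _ (summable_sum fun k _ => ?_)
    simp_rw [mul_pow]
    exact (ha k).mul_left _
  have hbd : ∀ i k, HasSum (fun j => (t j : ℝ) * (b i j * b k j))
      (if i = k then (d i : ℝ) else 0) := by
    intro i k
    have h1 : (if i = k then (d i : ℝ) else 0) =
        ∑ m, ∑ l, U l i * U m k * inner ℝ (x l) (x m) := by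
      have h2 := congr_fun (congr_fun hUd i) k
      rw [Matrix.diagonal_apply] at h2
      rw [← h2]
      simp only [Matrix.mul_apply, Matrix.transpose_apply, Matrix.gram_apply, Finset.sum_mul]
      exact Finset.sum_congr rfl fun m _ => Finset.sum_congr rfl fun l _ => by ring
    have h3 : ∀ j, (t j : ℝ) * (b i j * b k j) =
        ∑ m, ∑ l, U l i * U m k * ((t j : ℝ) * (a l j * a m j)) := by
      intro j
      rw [hb, Finset.sum_mul_sum, Finset.sum_comm, Finset.mul_sum]
      refine Finset.sum_congr rfl fun m _ => ?_
      rw [Finset.mul_sum]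
      exact Finset.sum_congr rfl fun l _ => by ring
    simp_rw [h3]
    rw [h1]
    exact hasSum_sum fun m _ => hasSum_sum fun l _ => (hx l m).mul_left _
  set Z' : Ω → ι → ℂ := fun ω i => ∑' j, (b i j : ℂ) * β j ω with hZ'
  set W' : Ω → ι → ℂ := fun ω i => ∑ k, (U k i : ℂ) * W k ω with hW'
  have hZlaw : HasLaw Z' (Measure.pi fun i => circularGaussian (d i)) μ :=
    hasLaw_tsum_mul hβ hβind ht hbsq hbd
  have hWlaw : HasLaw W' (Measure.pi fun _ => circularGaussian v) μ := by
    have h := hasLaw_tsum_mul hW hWind (t := fun _ => v) ⟨_, hasSum_fintype _⟩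
      (b := fun i k => U k i) (fun i => ⟨_, hasSum_fintype _⟩) (d := fun _ => v) (fun i k => by
        have h2 := congr_fun (congr_fun hUU i) k
        rw [Matrix.mul_apply, Matrix.one_apply] at h2
        have h3 : (if i = k then (v : ℝ) else 0) = ∑ j, (v : ℝ) * (U j i * U j k) := by
          rw [← Finset.mul_sum]
          simp only [Matrix.transpose_apply] at h2
          rw [h2]
          simp
        rw [h3]
        exact hasSum_fintype _)
    simpa only [tsum_fintype] using h
  have hcoord : ∀ j, HasLaw (fun y : J → ℂ => y j) (circularGaussian (t j)) (μ.map Y) := by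
    intro j
    refine ⟨(measurable_pi_apply j).aemeasurable, ?_⟩
    rw [AEMeasurable.map_map_of_aemeasurable (measurable_pi_apply j).aemeasurable hY]
    exact (hβ j).map_eq
  -- The channel lemma needs a measurable function of the input, while the series is handled only as
  -- an a.e. limit; a measurable version replaces it.
  have hh' : AEMeasurable (fun (y : J → ℂ) i => ∑' j, (b i j : ℂ) * y j) (μ.map Y) :=
    aemeasurable_pi_iff.2 fun i => aemeasurable_tsum_mul hcoord ht (hbsq i)
  have hhm := hh'.measurable_mk
  set h : (J → ℂ) → ι → ℂ := hh'.mk _ with hh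
  have hZh : Z' =ᵐ[μ] fun ω => h (Y ω) := ae_of_ae_map hY hh'.ae_eq_mk
  have hYW : IndepFun Y W' μ :=
    hβW.comp (φ := id) (ψ := fun (w : ι → ℂ) i => ∑ k, (U k i : ℂ) * w k) measurable_id
      (by fun_prop)
  have hhYlaw : HasLaw (fun ω => h (Y ω)) (Measure.pi fun i => circularGaussian (d i)) μ :=
    hZlaw.congr hZh.symm
  have hX'law := hasLaw_add_pi_circularGaussian hhYlaw hWlaw
    (hYW.comp (φ := h) (ψ := id) hhm measurable_id)
  have hchannel := mutualInfo_gaussianChannel hY hhm hv hWlaw hX'law (Filter.EventuallyEq.refl _ _)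
    hYW
  set X' : Ω → ι → ℂ := (fun ω => h (Y ω)) + W' with hX'
  have hrot : (fun ω i => ∑ k, (U k i : ℂ) * X ω k) =ᵐ[μ] X' := by
    filter_upwards [hZh, ae_forall_summable_mul hβ ht] with ω hω hsum
    rw [hX', Pi.add_apply, ← hω]
    ext i
    simp only [hX, hZ', hW', hb, Pi.add_apply, mul_add, Finset.sum_add_distrib]
    congr 1
    have h1 : ∀ j, ((∑ k, U k i * a k j : ℝ) : ℂ) * β j ω =
        ∑ k, (U k i : ℂ) * ((a k j : ℂ) * β j ω) := by
      intro j
      push_cast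
      rw [Finset.sum_mul]
      exact Finset.sum_congr rfl fun k _ => by ring
    simp_rw [h1]
    rw [Summable.tsum_finsetSum fun k _ => (hsum _ (ha k)).mul_left _]
    exact Finset.sum_congr rfl fun k _ => tsum_mul_left.symm
  have hback : (fun ω k => ∑ i, (U k i : ℂ) * X' ω i) =ᵐ[μ] X := by
    filter_upwards [hrot] with ω hω
    rw [← hω]
    ext k
    simp only [Finset.mul_sum]
    rw [Finset.sum_comm]
    have h1 : ∀ l, ∑ i, (U k i : ℂ) * ((U l i : ℂ) * X ω l) = if k = l then X ω l else 0 := by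
      intro l
      have h2 := congr_fun (congr_fun hUU' k) l
      simp only [Matrix.mul_apply, Matrix.one_apply, Matrix.transpose_apply] at h2
      simp_rw [← mul_assoc]
      rw [← Finset.sum_mul]
      have h3 : ∑ i, (U k i : ℂ) * (U l i : ℂ) = if k = l then 1 else 0 := by
        rw [← Complex.ofReal_one, ← Complex.ofReal_zero, ← apply_ite Complex.ofReal, ← h2]
        push_cast
        rfl
      rw [h3]
      split_ifs <;> simp
    simp_rw [h1]
    simp
  -- The rotation is invertible, so data processing in both directions gives equality.
  have hle1 := mutualInfo_comp_le hXm hY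
    (g := fun (z : ι → ℂ) i => ∑ k, (U k i : ℂ) * z k) (by fun_prop)
  have hle2 := mutualInfo_comp_le hX'law.aemeasurable hY
    (g := fun (z : ι → ℂ) k => ∑ i, (U k i : ℂ) * z i) (by fun_prop)
  rw [mutualInfo_congr hrot] at hle1
  rw [mutualInfo_congr hback] at hle2
  rw [le_antisymm hle2 hle1, hchannel, log_det_noisyGram_eq_sum hv x hUU hUd]

end LinearGaussianModel

/-! ### The full and the truncated array models -/

section ArrayModel

variable {Ω : Type*} [MeasurableSpace Ω] {μ : Measure Ω} [IsProbabilityMeasure μ]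

/-- The variances of the coefficients with index in `M`, extended by zero. -/
def restrictVar (M : Set ℤ) [DecidablePred (· ∈ M)] (s : ℤ → ℝ≥0) (m : ℤ) : ℝ≥0 :=
  if m ∈ M then s m else 0

lemma restrictVar_le (M : Set ℤ) [DecidablePred (· ∈ M)] (s : ℤ → ℝ≥0) (m : ℤ) :
    restrictVar M s m ≤ s m := by
  unfold restrictVar
  split_ifs <;> simp

lemma summable_restrictVar (M : Set ℤ) [DecidablePred (· ∈ M)] {s : ℤ → ℝ≥0} (hs : Summable s) :
    Summable (restrictVar M s) :=
  NNReal.summable_of_le (restrictVar_le M s) hs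

lemma tsum_restrictVar_le (M : Set ℤ) [DecidablePred (· ∈ M)] {s : ℤ → ℝ≥0} (hs : Summable s) :
    ∑' m, (restrictVar M s m : ℝ) ≤ ∑' m, (s m : ℝ) :=
  (NNReal.summable_coe.2 (summable_restrictVar M hs)).tsum_le_tsum
    (fun m => restrictVar_le M s m) (NNReal.summable_coe.2 hs)

lemma tsum_restrictVar_eq (M : Set ℤ) [DecidablePred (· ∈ M)] (s : ℤ → ℝ≥0) :
    ∑' m, (restrictVar M s m : ℝ) = ∑' m : M, (s m : ℝ) := by
  rw [tsum_subtype M fun m => (s m : ℝ)]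
  refine tsum_congr fun m => ?_
  unfold restrictVar
  by_cases hm : m ∈ M <;> simp [hm]

theorem fullInfo_eq {lam : ℝ} {s : ℤ → ℝ≥0} (hs : Summable s) {v : ℝ≥0} (hv : 0 < v)
    {β : ℤ → Ω → ℂ} {w : ℝ → Ω → ℂ} (hβ : ∀ m, HasLaw (β m) (circularGaussian (s m)) μ)
    (hw : ∀ x, HasLaw (w x) (circularGaussian v) μ) (hβ_indep : iIndepFun β μ)
    (hw_indep : iIndepFun w μ)
    (hβw_indep : IndepFun (fun ω m => β m ω) (fun ω x => w x ω) μ) (T : Finset ℝ) :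
    fullInfo μ lam β w T = ENNReal.ofReal (logDetInfo v (sceneVec lam s hs) T) := by
  have h := mutualInfo_linear_gaussian hβ hβ_indep hs hv (W := fun (x : T) => w x)
    (fun x => hw x) (hw_indep.precomp Subtype.val_injective)
    (hβw_indep.comp (φ := id) (ψ := fun (z : ℝ → ℂ) (x : T) => z x) measurable_id (by fun_prop))
    (a := fun x m => coeff lam x m) (fun x => summable_coeff_sq lam x)
    (x := fun x : T => sceneVec lam s hs x) fun x y => hasSum_inner_sceneVec lam s hs x y
  rw [Fintype.card_coe] at h
  exact h

/-- Zero variances outside `M` reproduce the covariances of the finite model, so both models can be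
compared inside one space `ℓ²`. -/
theorem truncInfo_eq {lam : ℝ} {s : ℤ → ℝ≥0} (hs : Summable s) {v : ℝ≥0} (hv : 0 < v)
    (M : Finset ℤ) {β : ℤ → Ω → ℂ} {w : ℝ → Ω → ℂ}
    (hβ : ∀ m, HasLaw (β m) (circularGaussian (s m)) μ)
    (hw : ∀ x, HasLaw (w x) (circularGaussian v) μ) (hβ_indep : iIndepFun β μ)
    (hw_indep : iIndepFun w μ)
    (hβw_indep : IndepFun (fun ω m => β m ω) (fun ω x => w x ω) μ) (T : Finset ℝ) :
    truncInfo μ lam M β w T = ENNReal.ofReal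
      (logDetInfo v (sceneVec lam (restrictVar M s) (summable_restrictVar M hs)) T) := by
  have h := mutualInfo_linear_gaussian (β := fun m : {m // m ∈ M} => β m) (t := fun m => s m)
    (fun m => hβ m) (hβ_indep.precomp Subtype.val_injective) ⟨_, hasSum_fintype _⟩ hv
    (W := fun (x : T) => w x) (fun x => hw x) (hw_indep.precomp Subtype.val_injective)
    (hβw_indep.comp (φ := fun (z : ℤ → ℂ) (m : {m // m ∈ M}) => z m)
      (ψ := fun (z : ℝ → ℂ) (x : T) => z x) (by fun_prop) (by fun_prop))
    (a := fun x m => coeff lam x m) (fun x => ⟨_, hasSum_fintype _⟩)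
    (x := fun x : T => sceneVec lam (restrictVar M s) (summable_restrictVar M hs) x) fun x y => by
      have h1 := hasSum_inner_sceneVec lam (restrictVar M s) (summable_restrictVar M hs) x y
      have h2 : HasSum (fun m => (restrictVar M s m : ℝ) * (coeff lam x m * coeff lam y m))
          (∑ m ∈ M, (restrictVar M s m : ℝ) * (coeff lam x m * coeff lam y m)) :=
        hasSum_sum_of_ne_finset_zero fun m hm => by simp [restrictVar, hm]
      rw [h1.unique h2, ← Finset.sum_coe_sort M]
      convert hasSum_fintype _ using 2 with m
      simp [restrictVar]
  rw [Fintype.card_coe] at h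
  simp only [tsum_fintype] at h
  refine Eq.trans ?_ h
  rw [truncInfo]
  congr 1
  ext ω x
  rw [truncReading, ← Finset.sum_coe_sort M]

/-- Truncating the model loses at most `log (1 + N ε / v)` per reading. -/
lemma logDetInfo_sceneVec_le_restrictVar (lam : ℝ) {s : ℤ → ℝ≥0} (hs : Summable s) {v : ℝ}
    (hv : 0 < v) (M : Finset ℤ) (N : ℕ) (T : Finset ℝ) (hT : T.card ≤ N) :
    logDetInfo v (sceneVec lam s hs) T ≤
      logDetInfo v (sceneVec lam (restrictVar M s) (summable_restrictVar M hs)) T +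
        T.card * Real.log (1 + N * (∑' m : {m : ℤ // m ∉ M}, (s m.1 : ℝ)) / v) := by
  set Mc : Set ℤ := (M : Set ℤ)ᶜ with hMc
  have hsplit : sceneVec lam s hs =
      sceneVec lam (restrictVar M s) (summable_restrictVar M hs) +
        sceneVec lam (restrictVar Mc s) (summable_restrictVar Mc hs) := by
    ext x m
    rw [Pi.add_apply, lp.coeFn_add, Pi.add_apply, sceneVec_apply, sceneVec_apply, sceneVec_apply]
    by_cases hm : m ∈ M <;> simp [restrictVar, hMc, hm]
  -- The two parts have disjoint supports, even for different positions.
  have horth : ∀ x y, inner ℝ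
      (sceneVec lam (restrictVar M s) (summable_restrictVar M hs) x)
      (sceneVec lam (restrictVar Mc s) (summable_restrictVar Mc hs) y) = 0 := by
    intro x y
    rw [lp.inner_eq_tsum]
    refine (tsum_congr fun m => ?_).trans tsum_zero
    rw [sceneVec_apply, sceneVec_apply]
    by_cases hm : m ∈ M <;> simp [restrictVar, hMc, hm]
  have htail : ∑' m, (restrictVar Mc s m : ℝ) = ∑' m : {m : ℤ // m ∉ M}, (s m.1 : ℝ) :=
    tsum_restrictVar_eq Mc s
  rw [hsplit]
  refine logDetInfo_add_orthogonal_le hv _ _ horth (fun x => ?_) N T hT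
  rw [← htail]
  exact norm_sceneVec_sq_le lam _ _ x

end ArrayModel

end ArrayDesign

/-! ### Combining truncation loss, grid loss and the greedy guarantee -/

theorem corollary1
    {Ω : Type*} [MeasurableSpace Ω] (μ : Measure Ω) [IsProbabilityMeasure μ]
    -- wavelength, coefficient variances, noise variance, scene coefficients, sensor noise
    (lam : ℝ) (hlam : 0 < lam)
    (s : ℤ → ℝ≥0) (hs : Summable s)
    (v : ℝ≥0) (hv : 0 < v)
    (β : ℤ → Ω → ℂ) (w : ℝ → Ω → ℂ)
    (hβ : ∀ m, HasLaw (β m) (ArrayDesign.circularGaussian (s m)) μ)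
    (hw : ∀ x, HasLaw (w x) (ArrayDesign.circularGaussian v) μ)
    (hβ_indep : iIndepFun β μ)
    (hw_indep : iIndepFun w μ)
    (hβw_indep : IndepFun (fun ω m => β m ω) (fun ω x => w x ω) μ)
    -- expected scene power, truncation set, truncation error, number of sensors
    (P : ℝ) (hP : P = ∑' m : ℤ, (s m : ℝ))
    (M : Finset ℤ) (ε : ℝ) (hε : ε = ∑' m : {m : ℤ // m ∉ M}, (s m.1 : ℝ))
    (N : ℕ) (hεN : ε * (N : ℝ) ^ (3 / 2 : ℝ) < (v : ℝ))
    -- aperture and grid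
    (A : Set ℝ) (δ : ℝ) (hδ : 0 < δ)
    (V : Finset ℝ) (hV : ArrayDesign.IsUniformGrid A δ V)
    -- output of the greedy algorithm
    (Sgr : Finset ℝ)
    (hgr : ArrayDesign.GreedyRun
      (fun T => (ArrayDesign.truncInfo μ lam M β w T).toReal) V N Sgr) :
    (∀ T : Finset ℝ, ArrayDesign.fullInfo μ lam β w T ≠ ∞ ∧
      ArrayDesign.truncInfo μ lam M β w T ≠ ∞) ∧
    ∀ S : Finset ℝ, (S : Set ℝ) ⊆ A → S.card ≤ N →
      (1 - 1 / Real.exp 1) *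
        ((ArrayDesign.fullInfo μ lam β w S).toReal -
          N * Real.log ((lam * v + 4 * δ * P * (1 + δ) * (N : ℝ) ^ (3 / 2 : ℝ)) /
            (lam * v - ε * lam * (N : ℝ) ^ (3 / 2 : ℝ))))
        ≤ (ArrayDesign.truncInfo μ lam M β w Sgr).toReal := by
  have hv' : (0 : ℝ) < v := hv
  have hfull := ArrayDesign.fullInfo_eq (lam := lam) hs hv hβ hw hβ_indep hw_indep hβw_indep
  have htrunc := ArrayDesign.truncInfo_eq (lam := lam) hs hv M hβ hw hβ_indep hw_indep hβw_indep
  refine ⟨fun T => ?_, fun S hS hcard => ?_⟩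
  · rw [hfull, htrunc]
    exact ⟨ENNReal.ofReal_ne_top, ENNReal.ofReal_ne_top⟩
  set sM := ArrayDesign.restrictVar M s
  have hsM : Summable sM := ArrayDesign.summable_restrictVar M hs
  set a := ArrayDesign.sceneVec lam sM hsM with ha
  have hG : (fun T => (ArrayDesign.truncInfo μ lam M β w T).toReal) =
      ArrayDesign.logDetInfo v a := by
    ext T
    rw [htrunc, ENNReal.toReal_ofReal (ArrayDesign.logDetInfo_nonneg hv' _ _)]
  have hG' := congr_fun hG Sgr
  rw [hG] at hgr
  rw [hG', hfull, ENNReal.toReal_ofReal (ArrayDesign.logDetInfo_nonneg hv' _ _)]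
  have hPM : ∑' m, (sM m : ℝ) ≤ P := hP ▸ ArrayDesign.tsum_restrictVar_le M hs
  have hP0 : 0 ≤ P := hP ▸ tsum_nonneg fun m => NNReal.coe_nonneg _
  have hε0 : 0 ≤ ε := hε ▸ tsum_nonneg fun m => NNReal.coe_nonneg _
  have hgreedy := hgr.one_sub_exp_mul_sub_le hδ hV hv' hP0 hlam a
    (fun x => Real.le_sqrt_of_sq_le ((ArrayDesign.norm_sceneVec_sq_le lam sM hsM x).trans hPM))
    (fun x y => (ArrayDesign.norm_sceneVec_sub_le hlam sM hsM x y).trans (by gcongr)) S hS hcard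
  have htr := ArrayDesign.logDetInfo_sceneVec_le_restrictVar lam hs hv' M N S hcard
  rw [← hε] at htr
  have he2 : (2 : ℝ) < Real.exp 1 := by linarith [Real.exp_one_gt_d9]
  have hq0 : 0 ≤ 1 - 1 / Real.exp 1 := by
    rw [sub_nonneg, div_le_one (by positivity)]
    linarith
  refine le_trans (mul_le_mul_of_nonneg_left ?_ hq0) hgreedy
  set R : ℝ := (N : ℝ) ^ (3 / 2 : ℝ) with hR
  -- The truncation argument needs only `N`; this passes to the stated power, with `N = 0` checked
  -- apart.
  have hNR : (N : ℝ) ≤ R := by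
    rcases Nat.eq_zero_or_pos N with h0 | h0
    · rw [hR, h0, Nat.cast_zero]
      exact Real.rpow_nonneg le_rfl _
    · exact Real.self_le_rpow_of_one_le (by exact_mod_cast h0) (by norm_num)
  have hR0 : 0 ≤ R := (Nat.cast_nonneg N).trans hNR
  -- The stated loss separates into a grid part and a truncation part.
  have hlog : Real.log ((lam * v + 4 * δ * P * (1 + δ) * R) / (lam * v - ε * lam * R)) =
      Real.log (1 + 4 * δ * P * (1 + δ) * R / (lam * v)) + Real.log (v / (v - ε * R)) := by
    have h1 : 0 < (v : ℝ) - ε * R := sub_pos.2 hεN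
    rw [← Real.log_mul (by positivity) (by positivity)]
    congr 1
    rw [show lam * (v : ℝ) - ε * lam * R = lam * (v - ε * R) by ring]
    field_simp
  have hεlog : S.card * Real.log (1 + N * ε / v) ≤ N * Real.log (v / (v - ε * R)) := by
    have h1 : 0 < (v : ℝ) - ε * R := sub_pos.2 hεN
    -- This is `(1 + x) (1 - y) ≤ 1` for `0 ≤ x ≤ y`, with `x = N ε / v` and `y = ε R / v`.
    have h2 : 1 + N * ε / v ≤ v / (v - ε * R) := by
      rw [le_div_iff₀ h1]
      have h3 : N * ε ≤ ε * R := by nlinarith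
      have h4 : (1 + N * ε / v) * (v - ε * R) = v - ε * R + N * ε - N * ε * (ε * R) / v := by
        field_simp
        ring
      rw [h4]
      have h5 : 0 ≤ N * ε * (ε * R) / v := by positivity
      linarith
    refine mul_le_mul (by exact_mod_cast hcard) (Real.log_le_log (by positivity) h2)
      (Real.log_nonneg (le_add_of_nonneg_right (by positivity))) (by positivity)
  rw [hlog]
  linarith
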